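/- \textbf{Setting.} Let $\mathcal X$ be a compact metric space, $K:\mathcal X\times\mathcal X\to\mathbb R$ a Mercer kernel (continuous, symmetric, positive semi-definite) with reproducing kernel Hilbert space $\mathcal H_K$, and put $K_x=K(\cdot,x)$. Let $\rho^{tr}_{\mathcal X},\rho^{te}_{\mathcal X}$ be Borel probability measures on $\mathcal X$ with $\rho^{te}_{\mathcal X}\ll\rho^{tr}_{\mathcal X}$, let $w=d\rho^{te}_{\mathcal X}/d\rho^{tr}_{\mathcal X}$, let $\rho(\cdot|x)$ be a Markov kernel from $\mathcal X$ to $\mathbb R$, let $\rho^{tr}(dx,dy)=\rho(dy|x)\,\rho^{tr}_{\mathcal X}(dx)$ and $f_\rho(x)=\int y\,d\rho(y|x)$. Assume that $|y|\le M$ for $\rho^{tr}$-almost every $(x,y)$. Let $L_Kf=\int_{\mathcal X} f(x)K_x\,d\rho^{te}_{\mathcal X}(x)$ on $L^2(\rho^{te}_{\mathcal X})$, a compact positive operator with powers $L_K^r$ defined by its spectral decomposition, and let $\|\cdot\|_{\rho^{te}_{\mathcal X}}$ be the norm of $L^2(\rho^{te}_{\mathcal X})$. \textbf{Filter.} Fix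 $U\ge\max\{1,\sup_{x}K(x,x)\}$. Let $g_\lambda:[0,U]\to\mathbb R$ $(0<\lambda\le U)$ be a filter function with qualification $\nu_g\in[1/2,\infty]$: there are constants $b>0$ and $\gamma_\nu>0$, for real $0<\nu\le\nu_g$, such that for all $0<\lambda\le U$ and $0<u\le U$, \[|g_\lambda(u)|\le b/\lambda,\qquad |g_\lambda(u)u|\le b,\qquad |1-g_\lambda(u)u|\,u^\nu\le\gamma_\nu\lambda^\nu .\] \textbf{Estimator.} Given an i.i.d. sample $\mathbf z=((x_i,y_i))_{i=1}^n$ from $\rho^{tr}$, let $\bar w(x_i)=w(x_i)/\big(\frac1n\sum_{j=1}^n w(x_j)\big)$, $\overline W=\mathrm{diag}(\bar w(x_1),\dots,\bar w(x_n))$, $\bar y=(y_1,\dots,y_n)^\top$, $S_Xf=(f(x_1),\dots,f(x_n))^\top$ for $f\in\mathcal H_K$, $S_X^\top u=\frac1n\sum_{i=1}^n u_iK_{x_i}$ for $u\in\mathbb R^n$, and \[f^{\overline{\mathbf w}}_{\mathbf z,\lambda}=g_\lambda\big(S_X^\top\overline WS_X\big)S_X^\top\overline W\bar y\in\mathcal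 H_K .\] \textbf{Assumptions.} (i) There are constants $0<\alpha\le1$, $C>0$, $\sigma>0$ such that for all integers $p\ge2$, \[\Big(\int_{\mathcal X} w^{(p-1)/\alpha}\,d\rho^{te}_{\mathcal X}\Big)^\alpha\le\tfrac12\,p!\,C^{p-2}\sigma^2 .\] (ii) $f_\rho=L_K^ru_\rho$ in $L^2(\rho^{te}_{\mathcal X})$ for some $u_\rho\in L^2(\rho^{te}_{\mathcal X})$ with $\|u_\rho\|_{\rho^{te}_{\mathcal X}}\le R$, where $1/2\le r\le\nu_g$. \textbf{Conclusion.} There is a constant $C'>0$, depending only on $K$ (with its domain $\mathcal X$), $U,\alpha,C,\sigma,M,R,r,\nu_g,b,(\gamma_\nu)_\nu$ and in particular not on $n$ or $\delta$, such that for all $n\ge1$ and $0<\delta<1$, with the choice $\lambda=n^{-\frac{1}{\min\{2r,3\}+1}}$, with confidence at least $1-\delta$, \[\big\|f^{\overline{\mathbf w}}_{\mathbf z,\lambda}-f_\rho\big\|_{\rho^{te}_{\mathcal X}}\le C'\,n^{-\frac{\min\{r,3/2\}}{\min\{2r,3\}+1}}\Big(\log\frac{12}{\delta}\Big)^3 .\]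 -/

import Mathlib

open MeasureTheory ProbabilityTheory
open scoped ENNReal

noncomputable section

namespace CovariateShift

/-- A Mercer kernel: a continuous, symmetric, positive semi-definite function. -/
structure IsMercerKernel {X : Type*} [TopologicalSpace X] (K : X → X → ℝ) : Prop where
  continuous : Continuous (Function.uncurry K)
  symm : ∀ x y, K x y = K y x
  posSemidef : ∀ (l : ℕ) (s : Fin l → X), (Matrix.of fun i j => K (s i) (s j)).PosSemidef

/-! ### Functions of an operator with an orthogonal eigendecomposition -/

/-- `g(T) v = ∑_μ g(μ) P_μ v`, where `P_μ` is the orthogonal projection onto the eigenspace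
`ker (T - μ I)`.  It is used for compact self-adjoint operators `T` only, for which the nonzero
`P_μ` are countably many, mutually orthogonal, with sum the identity. -/
def spectralApply {E : Type*} [NormedAddCommGroup E] [InnerProductSpace ℝ E] [CompleteSpace E]
    (T : E →L[ℝ] E) (g : ℝ → ℝ) (v : E) : E :=
  ∑' μ : ℝ, g μ • (Module.End.eigenspace (T : E →ₗ[ℝ] E) μ).starProjection v

/-! ### The integral operator on `L²` -/

theorem exists_kernel_bound {X : Type*} [TopologicalSpace X] [CompactSpace X] {K : X → X → ℝ}
    (hK : Continuous (Function.uncurry K)) : ∃ B : ℝ, 0 ≤ B ∧ ∀ x y, |K x y| ≤ B := by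
  obtain ⟨B, hB⟩ := isCompact_univ.exists_bound_of_continuousOn hK.continuousOn
  exact ⟨max B 0, le_max_right _ _, fun x y => (hB (x, y) trivial).trans (le_max_left _ _)⟩

theorem integrable_of_Lp {X : Type*} [MeasurableSpace X] (μ : Measure X) [IsProbabilityMeasure μ]
    (f : Lp ℝ 2 μ) : Integrable f μ := (Lp.memLp f).integrable (by norm_num)

section IntegralOperator

variable {X : Type*} [MetricSpace X] [CompactSpace X] [MeasurableSpace X] [BorelSpace X]

theorem integrable_mul_kernel {K : X → X → ℝ} (hK : Continuous (Function.uncurry K))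
    (μ : Measure X) [IsProbabilityMeasure μ] (f : Lp ℝ 2 μ) (s : X) :
    Integrable (fun x => f x * K x s) μ := by
  obtain ⟨B, -, hB⟩ := exists_kernel_bound hK
  have hc : Continuous fun x => K x s :=
    hK.comp (continuous_id.prodMk continuous_const)
  exact (integrable_of_Lp μ f).mul_bdd (c := B) hc.aestronglyMeasurable
    (Filter.Eventually.of_forall fun x => hB x s)

theorem continuous_integral_mul_kernel {K : X → X → ℝ} (hK : Continuous (Function.uncurry K))
    (μ : Measure X) [IsProbabilityMeasure μ] (f : Lp ℝ 2 μ) :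
    Continuous fun s => ∫ x, f x * K x s ∂μ := by
  obtain ⟨B, -, hB⟩ := exists_kernel_bound hK
  refine continuous_of_dominated (bound := fun x => |f x| * B)
    (fun s => (integrable_mul_kernel hK μ f s).aestronglyMeasurable) (fun s => ?_)
    ((integrable_of_Lp μ f).abs.mul_const B) ?_
  · exact Filter.Eventually.of_forall fun x => by
      rw [Real.norm_eq_abs, abs_mul]
      exact mul_le_mul_of_nonneg_left (hB x s) (abs_nonneg _)
  · exact Filter.Eventually.of_forall fun x =>
      continuous_const.mul (hK.comp (continuous_const.prodMk continuous_id))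

theorem memLp_integral_mul_kernel {K : X → X → ℝ} (hK : Continuous (Function.uncurry K))
    (μ : Measure X) [IsProbabilityMeasure μ] (f : Lp ℝ 2 μ) :
    MemLp (fun s => ∫ x, f x * K x s ∂μ) 2 μ := by
  have hc := continuous_integral_mul_kernel hK μ f
  obtain ⟨B, hB⟩ := isCompact_univ.exists_bound_of_continuousOn hc.continuousOn
  exact MemLp.of_bound hc.aestronglyMeasurable B
    (Filter.Eventually.of_forall fun x => hB x trivial)

/-- The integral operator as a linear map on `L²(μ)`: `(L_K f)(s) = ∫ f(x) K(x, s) dμ(x)`. -/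
def integralOperatorₗ {K : X → X → ℝ} (hK : Continuous (Function.uncurry K))
    (μ : Measure X) [IsProbabilityMeasure μ] : Lp ℝ 2 μ →ₗ[ℝ] Lp ℝ 2 μ where
  toFun f := (memLp_integral_mul_kernel hK μ f).toLp
  map_add' f g := by
    rw [← MemLp.toLp_add]
    refine MemLp.toLp_congr _ _ (Filter.Eventually.of_forall fun s => ?_)
    simp only [Pi.add_apply]
    rw [← integral_add (integrable_mul_kernel hK μ f s) (integrable_mul_kernel hK μ g s)]
    refine integral_congr_ae ?_
    filter_upwards [Lp.coeFn_add f g] with x hx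
    rw [hx, Pi.add_apply, add_mul]
  map_smul' c f := by
    rw [RingHom.id_apply, ← MemLp.toLp_const_smul]
    refine MemLp.toLp_congr _ _ (Filter.Eventually.of_forall fun s => ?_)
    simp only [Pi.smul_apply, smul_eq_mul]
    rw [← integral_const_mul]
    refine integral_congr_ae ?_
    filter_upwards [Lp.coeFn_smul c f] with x hx
    rw [hx, Pi.smul_apply, smul_eq_mul, mul_assoc]

theorem exists_integralOperator_bound {K : X → X → ℝ} (hK : Continuous (Function.uncurry K))
    (μ : Measure X) [IsProbabilityMeasure μ] :
    ∃ B : ℝ, ∀ f : Lp ℝ 2 μ, ‖integralOperatorₗ hK μ f‖ ≤ B * ‖f‖ := by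
  obtain ⟨B, hB0, hB⟩ := exists_kernel_bound hK
  refine ⟨B, fun f => ?_⟩
  have h1 : ∫ x, ‖f x‖ ∂μ ≤ ‖f‖ := by
    rw [integral_norm_eq_lintegral_enorm (Lp.aestronglyMeasurable f),
      ← eLpNorm_one_eq_lintegral_enorm, Lp.norm_def]
    exact ENNReal.toReal_mono (Lp.eLpNorm_ne_top f)
      (eLpNorm_le_eLpNorm_of_exponent_le (by norm_num) (Lp.aestronglyMeasurable f))
  have h2 : ∀ s, ‖∫ x, f x * K x s ∂μ‖ ≤ B * ‖f‖ := fun s => by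
    calc ‖∫ x, f x * K x s ∂μ‖ ≤ ∫ x, ‖f x‖ * B ∂μ := by
          refine norm_integral_le_of_norm_le ((integrable_of_Lp μ f).norm.mul_const B)
            (Filter.Eventually.of_forall fun x => ?_)
          rw [norm_mul]
          exact mul_le_mul_of_nonneg_left (hB x s) (norm_nonneg _)
      _ = B * ∫ x, ‖f x‖ ∂μ := by rw [integral_mul_const, mul_comm]
      _ ≤ B * ‖f‖ := mul_le_mul_of_nonneg_left h1 hB0
  have h3 := Lp.norm_le_of_ae_bound (f := integralOperatorₗ hK μ f)
    (C := B * ‖f‖) (mul_nonneg hB0 (norm_nonneg _)) (by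
      filter_upwards [(memLp_integral_mul_kernel hK μ f).coeFn_toLp] with s hs
      exact (congrArg norm hs).trans_le (h2 s))
  have h4 : measureUnivNNReal μ = 1 := by simp [measureUnivNNReal]
  simpa [h4] using h3

/-- The integral operator `L_K : L²(μ) → L²(μ)`, `(L_K f)(s) = ∫ f(x) K(x, s) dμ(x)`, as a
bounded operator. -/
def integralOperator {K : X → X → ℝ} (hK : Continuous (Function.uncurry K))
    (μ : Measure X) [IsProbabilityMeasure μ] : Lp ℝ 2 μ →L[ℝ] Lp ℝ 2 μ :=
  (integralOperatorₗ hK μ).mkContinuousOfExistsBound (exists_integralOperator_bound hK μ)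

end IntegralOperator

/-! ### Filter functions -/

/-- `g lam u` (with `0 < lam ≤ U`, `0 ≤ u ≤ U`) is a filter function with qualification
`νg ∈ [1/2, ∞]`, constant `b` and constants `γ ν`, `0 < ν ≤ νg`. -/
structure IsFilterFunction (U b : ℝ) (γ : ℝ → ℝ) (νg : EReal) (g : ℝ → ℝ → ℝ) : Prop where
  half_le : ((1 / 2 : ℝ) : EReal) ≤ νg
  b_pos : 0 < b
  γ_pos : ∀ ν : ℝ, 0 < ν → (ν : EReal) ≤ νg → 0 < γ ν
  bound : ∀ lam u : ℝ, 0 < lam → lam ≤ U → 0 < u → u ≤ U → |g lam u| ≤ b / lam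
  bound_mul : ∀ lam u : ℝ, 0 < lam → lam ≤ U → 0 < u → u ≤ U → |g lam u * u| ≤ b
  residual : ∀ ν : ℝ, 0 < ν → (ν : EReal) ≤ νg → ∀ lam u : ℝ, 0 < lam → lam ≤ U →
    0 < u → u ≤ U → |1 - g lam u * u| * u ^ ν ≤ γ ν * lam ^ ν

/-! ### The data-generating model -/

section Model

variable {X : Type*} [MeasurableSpace X]

/-- The regression function `f_ρ(x) = ∫ y dρ(y|x)`. -/
def regressionFunction (ρ : Kernel X ℝ) (x : X) : ℝ := ∫ y, y ∂(ρ x)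

/-- The weight (density ratio) `w = dρte/dρtr`. -/
def weight (ρtr ρte : Measure X) (x : X) : ℝ := (ρte.rnDeriv ρtr x).toReal

/-- The moment condition on the weight, for an exponent `0 < α ≤ 1`: for all integers `p ≥ 2`,
`(∫ w^((p-1)/α) dρte)^α ≤ (1/2) p! C^(p-2) σ²` (in particular the integrals are finite). -/
def WeightCondition (ρtr ρte : Measure X) (α C σ : ℝ) : Prop :=
  ∀ p : ℕ, 2 ≤ p →
    (∫⁻ x, ENNReal.ofReal (weight ρtr ρte x) ^ (((p : ℝ) - 1) / α) ∂ρte) ^ α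
      ≤ ENNReal.ofReal (1 / 2 * (p.factorial : ℝ) * C ^ (p - 2) * σ ^ 2)

/-- The normalized weights `w̄(x_i) = w(x_i) / ((1/n) ∑_j w(x_j))`. -/
def normalizedWeight (ρtr ρte : Measure X) {n : ℕ} (x : Fin n → X) (i : Fin n) : ℝ :=
  weight ρtr ρte (x i) / ((n : ℝ)⁻¹ * ∑ j, weight ρtr ρte (x j))

end Model

/-- The source condition `f_ρ = L_K^r u` in `L²(ρte)` for some `u ∈ L²(ρte)` of norm at
most `R`. -/
def SourceCondition {X : Type*} [MetricSpace X] [CompactSpace X] [MeasurableSpace X]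
    [BorelSpace X] {K : X → X → ℝ} (hK : IsMercerKernel K) (ρ : Kernel X ℝ)
    (ρte : Measure X) [IsProbabilityMeasure ρte] (r R : ℝ) : Prop :=
  ∃ u : Lp ℝ 2 ρte, ‖u‖ ≤ R ∧
    regressionFunction ρ =ᵐ[ρte]
      (spectralApply (integralOperator hK.continuous ρte) (fun t => t ^ r) u : Lp ℝ 2 ρte)

/-! ### The estimator -/

section Estimator

variable {X : Type*} (H : Type*) [NormedAddCommGroup H] [InnerProductSpace ℝ H]
  [RKHS ℝ H X ℝ]

/-- The sampling operator `S_X f = (f(x_1), …, f(x_n))`. -/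
def samplingOp {n : ℕ} (x : Fin n → X) : H →L[ℝ] (Fin n → ℝ) :=
  ContinuousLinearMap.pi fun i =>
    (ContinuousLinearMap.proj (x i)).comp (RKHS.coeCLM ℝ : H →L[ℝ] X → ℝ)

/-- `S_X^⊤ u = (1/n) ∑_i u_i K(·, x_i)`. -/
def samplingAdj [CompleteSpace H] {n : ℕ} (x : Fin n → X) : (Fin n → ℝ) →L[ℝ] H :=
  (n : ℝ)⁻¹ • ∑ i, (ContinuousLinearMap.proj i : (Fin n → ℝ) →L[ℝ] ℝ).smulRight
    (RKHS.kerFun H (x i) (1 : ℝ))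

/-- The diagonal matrix `diag(w_1, …, w_n)` as an operator on `ℝⁿ`. -/
def diagOp {n : ℕ} (w : Fin n → ℝ) : (Fin n → ℝ) →L[ℝ] (Fin n → ℝ) :=
  ContinuousLinearMap.pi fun i => w i • ContinuousLinearMap.proj i

/-- The spectral algorithm with weights `w` and filter `g` (at a fixed regularization parameter):
`g(S_X^⊤ W S_X) S_X^⊤ W y`. -/
def spectralEstimator [CompleteSpace H] (g : ℝ → ℝ) {n : ℕ} (x : Fin n → X) (w y : Fin n → ℝ) :
    H :=
  spectralApply (samplingAdj H x ∘L diagOp w ∘L samplingOp H x) g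
    (samplingAdj H x (diagOp w y))

/-- The spectral algorithm with normalized weights, computed from the sample
`z = ((x_1, y_1), …, (x_n, y_n))`. -/
def normalizedEstimator [CompleteSpace H] [MeasurableSpace X] (ρtr ρte : Measure X) (g : ℝ → ℝ)
    {n : ℕ} (z : Fin n → X × ℝ) : H :=
  spectralEstimator H g (fun i => (z i).1) (normalizedWeight ρtr ρte fun i => (z i).1)
    (fun i => (z i).2)

end Estimator

end CovariateShift

end

/-!
The rate is independent of the capacity of the kernel, so the exponent `α` plays no role: by
Jensen's inequality the weight condition for `α` implies the one for `1`, and this says that the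
weight `w` has Bernstein moments, hence an exponential moment, under the training marginal
(`lintegral_exp_weight_le`).

*Probability.*  For a centred vector `v`, the chord bound for the convex function `cosh ∘ √` shows
that `E cosh ‖x + v‖` exceeds `cosh ‖x‖` at most by the factor `E (exp ‖v‖ - ‖v‖)`
(`cosh_norm_add_le`).  Iterating over the sample and applying Markov's inequality gives a
dimension-free bound of order `log (12 / δ) / √n` for the weighted sample means
(`measure_norm_mean_sub_integral_gt_le`).  It is applied to three means: the weights themselves, the
empirical operator (in Hilbert-Schmidt norm, via the tensors `K_x ⊗ K_x`), and the noise
`w (y - f(x)) K_x`.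

*Analysis.* Let `J : H → L²(ρte)` be the embedding, so that `L_K = J J†`, and put `T = J† J`. The
source condition produces `f ∈ H` with `J f = f_ρ` and `f = T^s h`, `s = min(r, 3/2) - 1/2 ∈ [0,
1]` (`exists_eigenvector_expansion`); only eigenvectors of `L_K` with positive eigenvalues enter,
so compactness of `L_K` plays no role. If the empirical operator `S` is `ε`-close to `T`, the
error splits into a variance term, governed by the residual of `f` in the empirical equation, and
a bias term `(1 - g(S) S) T^s h`. The bias is compared with powers of `S` by a Cordes-type
inequality for `(S + λ)^(-s) T^s`, which follows from Hadamard's three lines theorem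
(`abs_sum_exp_mul_inner_le`, `norm_finCalc_rpow_sum_le`). Together these give
`norm_spectralApply_sub_le`. Since `r ≥ 1/2`, the parameter `λ` is at least `n ^ (-1/2)`, so `ε /
λ` is at most of order `log (12 / δ)`.

If `log (12 / δ)` exceeds a multiple of `√n`, then the mean of the weights may be close to zero; in
that case the trivial bound of order `1 / λ` on the estimator is already smaller than the claimed
one (`untypical_error_le`).
-/

namespace CovariateShift

/-! ### Concentration of vector-valued sample means -/

section Concentration

/-- Convexity of `cosh ∘ √` on `[0, ∞)`, along a convex combination of two squares. -/
theorem cosh_le_convex_combination {p q m a b : ℝ} (ha : 0 ≤ a) (hb : 0 ≤ b) (hab : a + b = 1)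
    (hm : m ^ 2 = a * p ^ 2 + b * q ^ 2) :
    Real.cosh m ≤ a * Real.cosh p + b * Real.cosh q := by
  refine hasSum_le (fun k => ?_) (Real.hasSum_cosh m)
    (((Real.hasSum_cosh p).mul_left a).add ((Real.hasSum_cosh q).mul_left b))
  have h := (convexOn_pow k).2 (Set.mem_Ici.2 (sq_nonneg p)) (Set.mem_Ici.2 (sq_nonneg q)) ha hb hab
  simp only [smul_eq_mul] at h
  rw [← mul_div_assoc, ← mul_div_assoc, ← add_div]
  simp only [pow_mul]
  rw [hm]
  gcongr

/-- In an inner product space, `cosh ‖·‖` grows at most by the factor `exp ‖v‖ - ‖v‖` under a step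
`v`, up to a term that is linear in `v` and hence averages out for a centred random `v`. -/
theorem cosh_norm_add_le {E : Type*} [NormedAddCommGroup E] [InnerProductSpace ℝ E] (x v : E) :
    Real.cosh ‖x + v‖ ≤ Real.cosh ‖x‖ * (Real.exp ‖v‖ - ‖v‖)
      + Real.sinh ‖x‖ / ‖x‖ * inner ℝ x v := by
  rcases eq_or_ne x 0 with rfl | hx
  · have h := Real.self_le_sinh_iff.2 (norm_nonneg v)
    have h' := Real.cosh_add_sinh ‖v‖
    simp only [zero_add, norm_zero, Real.cosh_zero, one_mul, inner_zero_left, mul_zero, add_zero]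
    linarith
  rcases eq_or_ne v 0 with rfl | hv
  · simp
  have ha : 0 < ‖x‖ := norm_pos_iff.2 hx
  have hc : 0 < ‖v‖ := norm_pos_iff.2 hv
  set a := ‖x‖
  set c := ‖v‖
  obtain ⟨t, ht⟩ : ∃ t : ℝ, inner ℝ x v = a * c * t :=
    ⟨inner ℝ x v / (a * c), by field_simp⟩
  have habs : |a * c * t| ≤ a * c := ht ▸ abs_real_inner_le_norm x v
  rw [abs_mul, abs_of_pos (mul_pos ha hc)] at habs
  have ht1 : |t| ≤ 1 := by
    by_contra hcon
    push Not at hcon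
    nlinarith [mul_pos ha hc]
  obtain ⟨h1, h2⟩ := abs_le.1 ht1
  have hsq : ‖x + v‖ ^ 2 = (1 + t) / 2 * (a + c) ^ 2 + (1 - t) / 2 * (a - c) ^ 2 := by
    rw [norm_add_sq_real, ht]; ring
  have hch := cosh_le_convex_combination (by linarith) (by linarith) (by ring) hsq
  rw [Real.cosh_add, Real.cosh_sub] at hch
  have hs : 0 ≤ Real.sinh a := Real.sinh_nonneg_iff.2 ha.le
  have hsc : c ≤ Real.sinh c := Real.self_le_sinh_iff.2 hc.le
  have hle : Real.sinh a ≤ Real.cosh a := (Real.sinh_lt_cosh a).le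
  have hexp := Real.cosh_add_sinh c
  have hmid : Real.sinh a * t * (Real.sinh c - c) ≤ Real.cosh a * (Real.sinh c - c) := by
    apply mul_le_mul_of_nonneg_right _ (by linarith)
    nlinarith
  have hlin : Real.sinh a / a * (a * c * t) = Real.sinh a * t * c := by field_simp
  rw [ht, hlin, ← hexp]
  nlinarith

/-- Scaling by `u` gains a factor `u ^ 2` in the exponential series from the second term on. -/
theorem exp_mul_sub_le {u x : ℝ} (hu : 0 ≤ u) (hu1 : u ≤ 1) (hx : 0 ≤ x) :
    Real.exp (u * x) - u * x ≤ 1 + u ^ 2 * Real.exp x := by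
  have hs : ∀ y : ℝ, HasSum (fun k : ℕ => y ^ k / (k.factorial : ℝ)) (Real.exp y) := fun y => by
    rw [Real.exp_eq_exp_ℝ]; exact NormedSpace.expSeries_div_hasSum_exp y
  have h1 := (hasSum_nat_add_iff' 2).2 (hs (u * x))
  have h2 := (hasSum_nat_add_iff' 2).2 (hs x)
  have h3 := hasSum_le (fun k => ?_) h1 (h2.mul_left (u ^ 2))
  · simp [Finset.sum_range_succ] at h3
    nlinarith [sq_nonneg u]
  · rw [mul_pow, mul_div_assoc, pow_add u]
    have : u ^ k ≤ 1 := pow_le_one₀ hu hu1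
    have h0 : 0 ≤ x ^ (k + 2) / ((k + 2).factorial : ℝ) := by positivity
    have := mul_le_mul_of_nonneg_right this (mul_nonneg (sq_nonneg u) h0)
    nlinarith

variable {Z : Type*} [MeasurableSpace Z] {E : Type*} [NormedAddCommGroup E] [InnerProductSpace ℝ E]

theorem lintegral_cosh_norm_add_le [CompleteSpace E] (P : Measure Z) [IsProbabilityMeasure P]
    {η : Z → E}
    (hη : Integrable η P) (hη0 : ∫ z, η z ∂P = 0) {A : ℝ} (hA : 0 ≤ A)
    (hexp : ∫⁻ z, ENNReal.ofReal (Real.exp ‖η z‖ - ‖η z‖) ∂P ≤ ENNReal.ofReal A) (x : E) :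
    ∫⁻ z, ENNReal.ofReal (Real.cosh ‖x + η z‖) ∂P
      ≤ ENNReal.ofReal (Real.cosh ‖x‖) * ENNReal.ofReal A := by
  have hpos : ∀ y : ℝ, 0 ≤ Real.exp y - y := fun y => by linarith [Real.add_one_le_exp y]
  have hm : AEStronglyMeasurable (fun z => Real.exp ‖η z‖ - ‖η z‖) P :=
    (Real.continuous_exp.comp_aestronglyMeasurable hη.1.norm).sub hη.1.norm
  have hint : Integrable (fun z => Real.exp ‖η z‖ - ‖η z‖) P := by
    refine ⟨hm, ?_⟩
    rw [hasFiniteIntegral_iff_ofReal (Filter.Eventually.of_forall fun z => hpos _)]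
    exact hexp.trans_lt ENNReal.ofReal_lt_top
  have hlin : Integrable (fun z => Real.sinh ‖x‖ / ‖x‖ * inner ℝ x (η z)) P :=
    (hη.const_inner x).const_mul _
  have hI : Integrable (fun z => Real.cosh ‖x‖ * (Real.exp ‖η z‖ - ‖η z‖)
      + Real.sinh ‖x‖ / ‖x‖ * inner ℝ x (η z)) P := (hint.const_mul (Real.cosh ‖x‖)).add hlin
  calc ∫⁻ z, ENNReal.ofReal (Real.cosh ‖x + η z‖) ∂P
      ≤ ∫⁻ z, ENNReal.ofReal (Real.cosh ‖x‖ * (Real.exp ‖η z‖ - ‖η z‖)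
          + Real.sinh ‖x‖ / ‖x‖ * inner ℝ x (η z)) ∂P :=
        lintegral_mono fun z => ENNReal.ofReal_le_ofReal (cosh_norm_add_le x (η z))
    _ = ENNReal.ofReal (∫ z, (Real.cosh ‖x‖ * (Real.exp ‖η z‖ - ‖η z‖)
          + Real.sinh ‖x‖ / ‖x‖ * inner ℝ x (η z)) ∂P) := by
        rw [ofReal_integral_eq_lintegral_ofReal hI]
        exact Filter.Eventually.of_forall fun z =>
          (Real.cosh_pos _).le.trans (cosh_norm_add_le x (η z))
    _ = ENNReal.ofReal (Real.cosh ‖x‖ * ∫ z, (Real.exp ‖η z‖ - ‖η z‖) ∂P) := by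
        rw [integral_add (hint.const_mul _) hlin, integral_const_mul, integral_const_mul,
          integral_inner hη, hη0, inner_zero_right, mul_zero, add_zero]
    _ ≤ ENNReal.ofReal (Real.cosh ‖x‖ * A) := by
        refine ENNReal.ofReal_le_ofReal
          (mul_le_mul_of_nonneg_left ?_ (Real.cosh_pos _).le)
        rw [← ENNReal.ofReal_le_ofReal_iff hA, ofReal_integral_eq_lintegral_ofReal hint
          (Filter.Eventually.of_forall fun z => hpos _)]
        exact hexp
    _ = _ := ENNReal.ofReal_mul (Real.cosh_pos _).le

/-- The exponential moment of a sum of independent centred vectors grows at most geometrically. -/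
theorem lintegral_pi_cosh_norm_sum_le [CompleteSpace E] (P : Measure Z) [IsProbabilityMeasure P]
    {η : Z → E}
    (hηm : StronglyMeasurable η) (hη : Integrable η P) (hη0 : ∫ z, η z ∂P = 0) {A : ℝ}
    (hA : 0 ≤ A)
    (hexp : ∫⁻ z, ENNReal.ofReal (Real.exp ‖η z‖ - ‖η z‖) ∂P ≤ ENNReal.ofReal A) (n : ℕ) (x : E) :
    ∫⁻ z, ENNReal.ofReal (Real.cosh ‖x + ∑ i, η (z i)‖) ∂(Measure.pi fun _ : Fin n => P)
      ≤ ENNReal.ofReal (Real.cosh ‖x‖) * ENNReal.ofReal A ^ n := by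
  induction n generalizing x with
  | zero => simp
  | succ n ih =>
    have hmp := measurePreserving_piFinSuccAbove (fun _ : Fin (n + 1) => P) 0
    have hmeas : Measurable fun q : Z × (Fin n → Z) =>
        ENNReal.ofReal (Real.cosh ‖(x + η q.1) + ∑ i, η (q.2 i)‖) := by
      have h1 : StronglyMeasurable fun q : Z × (Fin n → Z) =>
          (x + η q.1) + ∑ i, η (q.2 i) := by
        refine (stronglyMeasurable_const.add (hηm.comp_measurable measurable_fst)).add ?_
        exact Finset.stronglyMeasurable_fun_sum _ fun i _ =>
          hηm.comp_measurable ((measurable_pi_apply i).comp measurable_snd)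
      exact (Real.measurable_cosh.comp h1.norm.measurable).ennreal_ofReal
    calc ∫⁻ z, ENNReal.ofReal (Real.cosh ‖x + ∑ i, η (z i)‖)
            ∂(Measure.pi fun _ : Fin (n + 1) => P)
        = ∫⁻ q, ENNReal.ofReal (Real.cosh ‖(x + η q.1) + ∑ i, η (q.2 i)‖)
            ∂(P.prod (Measure.pi fun _ : Fin n => P)) := by
          rw [← hmp.lintegral_comp hmeas]
          refine lintegral_congr fun z => ?_
          rw [Fin.sum_univ_succ, ← add_assoc]
          rfl
      _ = ∫⁻ z₀, ∫⁻ z, ENNReal.ofReal (Real.cosh ‖(x + η z₀) + ∑ i, η (z i)‖)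
            ∂(Measure.pi fun _ : Fin n => P) ∂P := lintegral_prod _ hmeas.aemeasurable
      _ ≤ ∫⁻ z₀, ENNReal.ofReal (Real.cosh ‖x + η z₀‖) * ENNReal.ofReal A ^ n ∂P :=
          lintegral_mono fun z₀ => ih (x + η z₀)
      _ = (∫⁻ z₀, ENNReal.ofReal (Real.cosh ‖x + η z₀‖) ∂P) * ENNReal.ofReal A ^ n :=
          lintegral_mul_const' _ _ (ENNReal.pow_ne_top ENNReal.ofReal_ne_top)
      _ ≤ (ENNReal.ofReal (Real.cosh ‖x‖) * ENNReal.ofReal A) * ENNReal.ofReal A ^ n := by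
          gcongr
          exact lintegral_cosh_norm_add_le P hη hη0 hA hexp x
      _ = _ := by rw [pow_succ' _ n, mul_assoc]

/-- A dimension-free concentration inequality at rate `n ^ (-1/2)` for the sample mean of a
Hilbert-space valued variable dominated by a multiple of a real weight of mean one with an
exponential moment. -/
theorem measure_norm_mean_sub_integral_gt_le [CompleteSpace E] (P : Measure Z)
    [IsProbabilityMeasure P]
    {ξ : Z → E} (hξ : StronglyMeasurable ξ) {W : Z → ℝ} (hW0 : ∀ z, 0 ≤ W z)
    (hWi : Integrable W P) (hW1 : ∫ z, W z ∂P = 1) {B a D : ℝ} (hB : 0 < B) (ha : 0 < a)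
    (hD : 0 ≤ D)
    (hbd : ∀ᵐ z ∂P, ‖ξ z‖ ≤ B * W z)
    (hexp : ∫⁻ z, ENNReal.ofReal (Real.exp (a * (1 + W z))) ∂P ≤ ENNReal.ofReal D)
    {n : ℕ} (hn : 1 ≤ n) {δ : ℝ} (hδ : 0 < δ) :
    Measure.pi (fun _ : Fin n => P)
      {z | B / a * (D + Real.log (2 / δ)) / √n < ‖(n : ℝ)⁻¹ • ∑ i, ξ (z i) - ∫ z, ξ z ∂P‖}
      ≤ ENNReal.ofReal δ := by
  have hn0 : (0 : ℝ) < n := by exact_mod_cast hn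
  have hsn : 0 < √(n : ℝ) := Real.sqrt_pos.2 hn0
  have hsq : √(n : ℝ) * √n = n := Real.mul_self_sqrt hn0.le
  have hξi : Integrable ξ P := (hWi.const_mul B).mono' hξ.aestronglyMeasurable hbd
  set m : E := ∫ z, ξ z ∂P with hm
  have hmB : ‖m‖ ≤ B := by
    calc ‖m‖ ≤ ∫ z, B * W z ∂P := norm_integral_le_of_norm_le (hWi.const_mul B) hbd
      _ = B := by rw [integral_const_mul, hW1, mul_one]
  -- at this scale `(θ B / a) ^ 2 = 1 / n`, so a product of `n` one-step factors stays bounded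
  set θ : ℝ := a / (B * √n) with hθ
  have hθ0 : 0 < θ := by positivity
  set η : Z → E := fun z => θ • (ξ z - m) with hηdef
  have hηm : StronglyMeasurable η := (hξ.sub stronglyMeasurable_const).const_smul θ
  have hηi : Integrable η P := (hξi.sub (integrable_const m)).smul θ
  have hη0 : ∫ z, η z ∂P = 0 := by
    rw [hηdef, integral_smul, integral_sub hξi (integrable_const m)]
    simp [hm]
  have hηb : ∀ᵐ z ∂P, Real.exp ‖η z‖ - ‖η z‖
      ≤ 1 + (n : ℝ)⁻¹ * Real.exp (a * (1 + W z)) := by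
    filter_upwards [hbd] with z hz
    have h1 : ‖η z‖ ≤ (√n)⁻¹ * (a * (1 + W z)) := by
      rw [hηdef, norm_smul, Real.norm_of_nonneg hθ0.le]
      calc θ * ‖ξ z - m‖ ≤ θ * (B * (1 + W z)) := by
            gcongr
            linarith [norm_sub_le (ξ z) m]
        _ = _ := by rw [hθ]; field_simp
    have h2 : Real.exp ‖η z‖ - ‖η z‖ ≤ Real.exp ((√n)⁻¹ * (a * (1 + W z)))
        - (√n)⁻¹ * (a * (1 + W z)) := by
      set y := (√(n : ℝ))⁻¹ * (a * (1 + W z))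
      have h3 : Real.exp y = Real.exp ‖η z‖ * Real.exp (y - ‖η z‖) := by
        rw [← Real.exp_add]; congr 1; ring
      have h4 := Real.add_one_le_exp (y - ‖η z‖)
      have h5 : 1 ≤ Real.exp ‖η z‖ := Real.one_le_exp (norm_nonneg _)
      nlinarith
    refine h2.trans ?_
    have hs1 : (√(n : ℝ))⁻¹ ≤ 1 := by
      rw [inv_le_one₀ hsn]
      exact Real.one_le_sqrt.2 (by exact_mod_cast hn)
    refine (exp_mul_sub_le (by positivity) hs1
      (mul_nonneg ha.le (by linarith [hW0 z]))).trans (le_of_eq ?_)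
    rw [inv_pow, Real.sq_sqrt hn0.le]
  have hηexp : ∫⁻ z, ENNReal.ofReal (Real.exp ‖η z‖ - ‖η z‖) ∂P
      ≤ ENNReal.ofReal (1 + (n : ℝ)⁻¹ * D) := by
    calc _ ≤ ∫⁻ z, ENNReal.ofReal (1 + (n : ℝ)⁻¹ * Real.exp (a * (1 + W z))) ∂P :=
          lintegral_mono_ae (hηb.mono fun z hz => ENNReal.ofReal_le_ofReal hz)
      _ = ∫⁻ z, (1 + ENNReal.ofReal (n : ℝ)⁻¹ * ENNReal.ofReal (Real.exp (a * (1 + W z)))) ∂P := by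
          refine lintegral_congr fun z => ?_
          rw [ENNReal.ofReal_add zero_le_one (by positivity), ENNReal.ofReal_one,
            ENNReal.ofReal_mul (by positivity)]
      _ = 1 + ENNReal.ofReal (n : ℝ)⁻¹ * ∫⁻ z, ENNReal.ofReal (Real.exp (a * (1 + W z))) ∂P := by
          rw [lintegral_add_left measurable_const, lintegral_const_mul' _ _ ENNReal.ofReal_ne_top]
          simp
      _ ≤ 1 + ENNReal.ofReal (n : ℝ)⁻¹ * ENNReal.ofReal D := by gcongr
      _ = _ := by
          rw [ENNReal.ofReal_add zero_le_one (by positivity), ENNReal.ofReal_one,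
            ENNReal.ofReal_mul (by positivity)]
  have hmain := lintegral_pi_cosh_norm_sum_le P hηm hηi hη0 (A := 1 + (n : ℝ)⁻¹ * D)
    (by positivity) hηexp n 0
  have hAn : ENNReal.ofReal (1 + (n : ℝ)⁻¹ * D) ^ n ≤ ENNReal.ofReal (Real.exp D) := by
    rw [← ENNReal.ofReal_pow (by positivity)]
    apply ENNReal.ofReal_le_ofReal
    calc (1 + (n : ℝ)⁻¹ * D) ^ n ≤ Real.exp ((n : ℝ)⁻¹ * D) ^ n := by
          gcongr
          linarith [Real.add_one_le_exp ((n : ℝ)⁻¹ * D)]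
      _ = Real.exp D := by rw [← Real.exp_nat_mul]; congr 1; field_simp
  simp only [zero_add, norm_zero, Real.cosh_zero, ENNReal.ofReal_one, one_mul] at hmain
  have hmain' := hmain.trans hAn
  -- Markov's inequality for `cosh`, at the level `exp D / δ = exp L / 2`
  set L : ℝ := D + Real.log (2 / δ) with hL
  have hmeas : AEMeasurable (fun z : Fin n → Z => ENNReal.ofReal (Real.cosh ‖∑ i, η (z i)‖))
      (Measure.pi fun _ : Fin n => P) := by
    have h1 : StronglyMeasurable fun q : Fin n → Z => ∑ i, η (q i) :=
      Finset.stronglyMeasurable_fun_sum _ fun i _ => hηm.comp_measurable (measurable_pi_apply i)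
    exact (Real.measurable_cosh.comp h1.norm.measurable).ennreal_ofReal.aemeasurable
  have hexpL : Real.exp L = Real.exp D * (2 / δ) := by
    rw [hL, Real.exp_add, Real.exp_log (by positivity)]
  have hset : {z : Fin n → Z | B / a * L / √n < ‖(n : ℝ)⁻¹ • ∑ i, ξ (z i) - m‖}
      ⊆ {z | ENNReal.ofReal (Real.exp D / δ) ≤ ENNReal.ofReal (Real.cosh ‖∑ i, η (z i)‖)} := by
    intro z hz
    simp only [Set.mem_ofPred_eq] at hz ⊢
    apply ENNReal.ofReal_le_ofReal
    have h1 : ∑ i, η (z i) = (θ * n) • ((n : ℝ)⁻¹ • ∑ i, ξ (z i) - m) := by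
      simp only [hηdef]
      rw [← Finset.smul_sum, Finset.sum_sub_distrib, mul_smul, smul_sub (n : ℝ), smul_smul,
        mul_inv_cancel₀ hn0.ne', one_smul]
      simp [Nat.cast_smul_eq_nsmul]
    have h2 : L ≤ ‖∑ i, η (z i)‖ := by
      rw [h1, norm_smul, Real.norm_of_nonneg (by positivity)]
      calc L = θ * n * (B / a * L / √n) := by
            rw [hθ]; field_simp; rw [sq, hsq]
        _ ≤ _ := by gcongr
    have h3 : Real.exp L ≤ Real.exp ‖∑ i, η (z i)‖ := Real.exp_le_exp.2 h2
    rw [Real.cosh_eq]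
    have h4 := Real.exp_pos (-‖∑ i, η (z i)‖)
    rw [hexpL] at h3
    have : Real.exp D * (2 / δ) = 2 * (Real.exp D / δ) := by ring
    linarith
  refine (measure_mono hset).trans ?_
  have hq0 : 0 < Real.exp D / δ := div_pos (Real.exp_pos D) hδ
  refine (meas_ge_le_lintegral_div hmeas (by simpa using hq0) ENNReal.ofReal_ne_top).trans ?_
  refine (ENNReal.div_le_div_right hmain' _).trans ?_
  rw [← ENNReal.ofReal_div_of_pos hq0]
  apply ENNReal.ofReal_le_ofReal
  have := Real.exp_pos D
  apply le_of_eq; field_simp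

end Concentration

/-! ### The importance weight -/

section Weight

variable {X : Type*} [MeasurableSpace X] {ρtr ρte : Measure X}

theorem measurable_weight : Measurable (weight ρtr ρte) :=
  (Measure.measurable_rnDeriv ρte ρtr).ennreal_toReal

theorem weight_nonneg (x : X) : 0 ≤ weight ρtr ρte x := ENNReal.toReal_nonneg

theorem ofReal_weight_ae [IsProbabilityMeasure ρte] [IsProbabilityMeasure ρtr] :
    (fun x => ENNReal.ofReal (weight ρtr ρte x)) =ᵐ[ρtr] ρte.rnDeriv ρtr := by
  filter_upwards [Measure.rnDeriv_lt_top ρte ρtr] with x hx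
  exact ENNReal.ofReal_toReal hx.ne

theorem lintegral_weight_mul [IsProbabilityMeasure ρte] [IsProbabilityMeasure ρtr]
    (hac : ρte.AbsolutelyContinuous ρtr) {f : X → ℝ≥0∞} (hf : Measurable f) :
    ∫⁻ x, ENNReal.ofReal (weight ρtr ρte x) * f x ∂ρtr = ∫⁻ x, f x ∂ρte := by
  rw [← lintegral_rnDeriv_mul hac hf.aemeasurable]
  refine lintegral_congr_ae ?_
  filter_upwards [ofReal_weight_ae (ρtr := ρtr) (ρte := ρte)] with x hx
  rw [hx]

theorem integrable_weight [IsProbabilityMeasure ρte] [IsProbabilityMeasure ρtr] :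
    Integrable (weight ρtr ρte) ρtr := Measure.integrable_toReal_rnDeriv

theorem integral_weight [IsProbabilityMeasure ρte] [IsProbabilityMeasure ρtr]
    (hac : ρte.AbsolutelyContinuous ρtr) : ∫ x, weight ρtr ρte x ∂ρtr = 1 := by
  simp [weight, Measure.integral_toReal_rnDeriv hac]

/-- The moments of the weight under the training marginal are of Bernstein type: by Jensen's
inequality the weight condition for `α` is strongest for small `α`. -/
theorem lintegral_weight_pow_le [IsProbabilityMeasure ρte] [IsProbabilityMeasure ρtr]
    (hac : ρte.AbsolutelyContinuous ρtr) {α C σ : ℝ} (hα : 0 < α) (hα1 : α ≤ 1)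
    (hw : WeightCondition ρtr ρte α C σ) {p : ℕ} (hp : 2 ≤ p) :
    ∫⁻ x, ENNReal.ofReal (weight ρtr ρte x) ^ p ∂ρtr
      ≤ ENNReal.ofReal (1 / 2 * (p.factorial : ℝ) * C ^ (p - 2) * σ ^ 2) := by
  refine le_trans ?_ (hw p hp)
  have hm : Measurable fun x => ENNReal.ofReal (weight ρtr ρte x) :=
    measurable_weight.ennreal_ofReal
  have h1 : ∫⁻ x, ENNReal.ofReal (weight ρtr ρte x) ^ p ∂ρtr
      = ∫⁻ x, ENNReal.ofReal (weight ρtr ρte x) ^ (p - 1) ∂ρte := by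
    rw [← lintegral_weight_mul hac (hm.pow_const (p - 1))]
    refine lintegral_congr fun x => ?_
    rw [← pow_succ', Nat.sub_add_cancel (by omega)]
  have h2 := eLpNorm'_le_eLpNorm'_of_exponent_le (p := 1) (q := 1 / α) zero_lt_one
    ((one_le_div hα).2 hα1) ρte
    (f := fun x => ENNReal.ofReal (weight ρtr ρte x) ^ (p - 1))
    (hm.pow_const (p - 1)).aestronglyMeasurable
  simp only [eLpNorm', enorm_eq_self, ENNReal.rpow_one, div_one, one_div_one_div] at h2
  rw [h1]
  refine h2.trans (le_of_eq ?_)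
  congr 1
  refine lintegral_congr fun x => ?_
  rw [← ENNReal.rpow_natCast, ← ENNReal.rpow_mul, Nat.cast_sub (by omega)]
  congr 1
  push_cast; ring

/-- Exponential moment of the weight: at the rate `1 / (2 C)` the Bernstein moments make the
exponential series geometric with ratio `1 / 2`. -/
theorem lintegral_exp_weight_le [IsProbabilityMeasure ρte] [IsProbabilityMeasure ρtr]
    (hac : ρte.AbsolutelyContinuous ρtr) {α C σ : ℝ} (hα : 0 < α) (hα1 : α ≤ 1) (hC : 0 < C)
    (hw : WeightCondition ρtr ρte α C σ) :
    ∫⁻ x, ENNReal.ofReal (Real.exp (1 / (2 * C) * (1 + weight ρtr ρte x))) ∂ρtr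
      ≤ ENNReal.ofReal (Real.exp (1 / (2 * C)) *
          (1 + 1 / (2 * C) + (1 / (2 * C)) ^ 2 * σ ^ 2)) := by
  set a : ℝ := 1 / (2 * C) with ha
  have ha0 : 0 < a := by positivity
  have haC : a * C = 1 / 2 := by rw [ha]; field_simp
  have hm : Measurable fun x => ENNReal.ofReal (weight ρtr ρte x) :=
    measurable_weight.ennreal_ofReal
  have hmk : ∀ k : ℕ, Measurable fun x => ENNReal.ofReal (a ^ (k + 2) / (k + 2).factorial) *
      ENNReal.ofReal (weight ρtr ρte x) ^ (k + 2) := fun k => (hm.pow_const _).const_mul _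
  have hpt : ∀ x, ENNReal.ofReal (Real.exp (a * (1 + weight ρtr ρte x)))
      = ENNReal.ofReal (Real.exp a) * (1 + (ENNReal.ofReal a * ENNReal.ofReal (weight ρtr ρte x)
        + ∑' k : ℕ, ENNReal.ofReal (a ^ (k + 2) / (k + 2).factorial) *
          ENNReal.ofReal (weight ρtr ρte x) ^ (k + 2))) := by
    intro x
    have hw0 : 0 ≤ weight ρtr ρte x := weight_nonneg x
    set y := weight ρtr ρte x
    have hs : HasSum (fun k : ℕ => (a * y) ^ k / (k.factorial : ℝ)) (Real.exp (a * y)) := by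
      rw [Real.exp_eq_exp_ℝ]; exact NormedSpace.expSeries_div_hasSum_exp _
    have h2 := (hasSum_nat_add_iff' 2).2 hs
    have hnn : ∀ k : ℕ, 0 ≤ (a * y) ^ (k + 2) / ((k + 2).factorial : ℝ) := fun k => by positivity
    have h3 := ENNReal.ofReal_tsum_of_nonneg hnn h2.summable
    rw [h2.tsum_eq] at h3
    simp only [Finset.sum_range_succ, Finset.range_one, Finset.sum_singleton, pow_zero,
      Nat.factorial_zero, Nat.cast_one, div_one, pow_one, Nat.factorial_one] at h3
    have h4 : 0 ≤ Real.exp (a * y) - (1 + a * y) := by linarith [Real.add_one_le_exp (a * y)]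
    have h5 : Real.exp (a * (1 + y))
        = Real.exp a * (1 + (a * y + (Real.exp (a * y) - (1 + a * y)))) := by
      rw [mul_add, mul_one, Real.exp_add]; ring
    rw [h5, ENNReal.ofReal_mul (Real.exp_pos a).le,
      ENNReal.ofReal_add zero_le_one (by positivity), ENNReal.ofReal_one,
      ENNReal.ofReal_add (by positivity) h4, h3, ENNReal.ofReal_mul ha0.le]
    congr 4
    funext k
    rw [← ENNReal.ofReal_pow hw0, ← ENNReal.ofReal_mul (by positivity), mul_pow]
    congr 1; ring
  have hterm : ∀ k : ℕ, ∫⁻ x, ENNReal.ofReal (a ^ (k + 2) / (k + 2).factorial) *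
      ENNReal.ofReal (weight ρtr ρte x) ^ (k + 2) ∂ρtr
      ≤ ENNReal.ofReal (1 / 2 * a ^ 2 * σ ^ 2 * (1 / 2) ^ k) := by
    intro k
    rw [lintegral_const_mul' _ _ ENNReal.ofReal_ne_top]
    refine (mul_le_mul_right (lintegral_weight_pow_le hac hα hα1 hw (p := k + 2) (by omega))
      _).trans ?_
    rw [← ENNReal.ofReal_mul (by positivity)]
    refine ENNReal.ofReal_le_ofReal (le_of_eq ?_)
    have hf : ((k + 2).factorial : ℝ) ≠ 0 := by positivity
    rw [Nat.add_sub_cancel, ← haC, mul_pow, pow_add]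
    field_simp
  have hsum : ∑' k : ℕ, ∫⁻ x, ENNReal.ofReal (a ^ (k + 2) / (k + 2).factorial) *
      ENNReal.ofReal (weight ρtr ρte x) ^ (k + 2) ∂ρtr ≤ ENNReal.ofReal (a ^ 2 * σ ^ 2) := by
    refine (ENNReal.tsum_le_tsum hterm).trans ?_
    have hg := hasSum_geometric_two.mul_left (1 / 2 * a ^ 2 * σ ^ 2)
    rw [← ENNReal.ofReal_tsum_of_nonneg (fun k => by positivity) hg.summable, hg.tsum_eq]
    exact ENNReal.ofReal_le_ofReal (le_of_eq (by ring))
  have hw1 : ∫⁻ x, ENNReal.ofReal (weight ρtr ρte x) ∂ρtr = 1 := by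
    have := lintegral_weight_mul hac (f := fun _ => 1) measurable_const
    simpa using this
  calc _ = ∫⁻ x, ENNReal.ofReal (Real.exp a) * (1 + (ENNReal.ofReal a *
        ENNReal.ofReal (weight ρtr ρte x) + ∑' k : ℕ, ENNReal.ofReal (a ^ (k + 2) /
          (k + 2).factorial) * ENNReal.ofReal (weight ρtr ρte x) ^ (k + 2))) ∂ρtr :=
        lintegral_congr hpt
    _ = ENNReal.ofReal (Real.exp a) * (1 + (ENNReal.ofReal a + ∑' k : ℕ,
        ∫⁻ x, ENNReal.ofReal (a ^ (k + 2) / (k + 2).factorial) *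
          ENNReal.ofReal (weight ρtr ρte x) ^ (k + 2) ∂ρtr)) := by
        rw [lintegral_const_mul' _ _ ENNReal.ofReal_ne_top, lintegral_add_left measurable_const,
          lintegral_add_left (hm.const_mul _), lintegral_const_mul' _ _ ENNReal.ofReal_ne_top,
          hw1, lintegral_tsum fun k => (hmk k).aemeasurable]
        simp
    _ ≤ ENNReal.ofReal (Real.exp a) *
          (1 + (ENNReal.ofReal a + ENNReal.ofReal (a ^ 2 * σ ^ 2))) := by
        gcongr
    _ = _ := by
        rw [ENNReal.ofReal_mul (Real.exp_pos a).le, add_assoc,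
          ENNReal.ofReal_add zero_le_one (by positivity), ENNReal.ofReal_one,
          ENNReal.ofReal_add ha0.le (by positivity)]

end Weight

/-! ### Functional calculus with finitely many eigenvalues, and interpolation -/

theorem norm_sq_sum_of_orthogonal {E ι : Type*} [NormedAddCommGroup E]
    [InnerProductSpace ℝ E] {S : Finset ι} {p : ι → E}
    (hp : ∀ i ∈ S, ∀ j ∈ S, i ≠ j → inner ℝ (p i) (p j) = 0) :
    ‖∑ i ∈ S, p i‖ ^ 2 = ∑ i ∈ S, ‖p i‖ ^ 2 := by
  rw [← real_inner_self_eq_norm_sq, sum_inner]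
  refine Finset.sum_congr rfl fun i hi => ?_
  rw [inner_sum, Finset.sum_eq_single i, real_inner_self_eq_norm_sq]
  · exact fun j hj hij => hp i hi j hj hij.symm
  · exact fun hh => absurd hi hh

section FiniteCalculus

variable {E : Type*} [NormedAddCommGroup E] [InnerProductSpace ℝ E] [CompleteSpace E]

/-- The orthogonal projection onto the eigenspace of `T` for `μ` (zero if `μ` is no eigenvalue). -/
noncomputable def eigenProj (T : E →L[ℝ] E) (μ : ℝ) : E →L[ℝ] E :=
  (Module.End.eigenspace (T : E →ₗ[ℝ] E) μ).starProjection

/-- `φ(T)` for an operator `T` whose eigenvalues lie in the finite set `s`. -/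
noncomputable def finCalc (T : E →L[ℝ] E) (s : Finset ℝ) (φ : ℝ → ℝ) : E →L[ℝ] E :=
  ∑ μ ∈ s, φ μ • eigenProj T μ

/-- `T` is symmetric, and the projections onto its eigenspaces for the finitely many values in `s`
sum to the identity. -/
structure HasFiniteResolution (T : E →L[ℝ] E) (s : Finset ℝ) : Prop where
  symm : (T : E →ₗ[ℝ] E).IsSymmetric
  sum_eigenProj : ∀ v, ∑ μ ∈ s, eigenProj T μ v = v

theorem finCalc_apply (T : E →L[ℝ] E) (s : Finset ℝ) (φ : ℝ → ℝ) (v : E) :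
    finCalc T s φ v = ∑ μ ∈ s, φ μ • eigenProj T μ v := by
  simp [finCalc]

theorem eigenProj_mem (T : E →L[ℝ] E) (μ : ℝ) (v : E) :
    eigenProj T μ v ∈ Module.End.eigenspace (T : E →ₗ[ℝ] E) μ :=
  Submodule.starProjection_apply_mem _ v

theorem apply_eigenProj (T : E →L[ℝ] E) (μ : ℝ) (v : E) :
    T (eigenProj T μ v) = μ • eigenProj T μ v :=
  Module.End.mem_eigenspace_iff.1 (eigenProj_mem T μ v)

theorem inner_eigenProj (T : E →L[ℝ] E) (μ : ℝ) (u v : E) :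
    inner ℝ (eigenProj T μ u) v = inner ℝ u (eigenProj T μ v) :=
  Submodule.inner_starProjection_left_eq_right _ u v

theorem eigenProj_eigenProj_self (T : E →L[ℝ] E) (μ : ℝ) (v : E) :
    eigenProj T μ (eigenProj T μ v) = eigenProj T μ v :=
  Submodule.starProjection_eq_self_iff.2 (eigenProj_mem T μ v)

theorem inner_eigenProj_eigenProj {T : E →L[ℝ] E} (hT : (T : E →ₗ[ℝ] E).IsSymmetric) {μ ν : ℝ}
    (h : μ ≠ ν) (u v : E) : inner ℝ (eigenProj T μ u) (eigenProj T ν v) = 0 :=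
  hT.orthogonalFamily_eigenspaces h ⟨_, eigenProj_mem T μ u⟩ ⟨_, eigenProj_mem T ν v⟩

theorem eigenProj_eigenProj_of_ne {T : E →L[ℝ] E} (hT : (T : E →ₗ[ℝ] E).IsSymmetric) {μ ν : ℝ}
    (h : μ ≠ ν) (v : E) : eigenProj T μ (eigenProj T ν v) = 0 := by
  rw [← inner_self_eq_zero (𝕜 := ℝ), inner_eigenProj, eigenProj_eigenProj_self,
    real_inner_comm, inner_eigenProj_eigenProj hT h]

namespace HasFiniteResolution

variable {T : E →L[ℝ] E} {s : Finset ℝ}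

theorem eigenProj_eq_zero (h : HasFiniteResolution T s) {μ : ℝ} (hμ : μ ∉ s) (v : E) :
    eigenProj T μ v = 0 := by
  rw [← h.sum_eigenProj (eigenProj T μ v)]
  exact Finset.sum_eq_zero fun ν hν =>
    eigenProj_eigenProj_of_ne h.symm (ne_of_mem_of_not_mem hν hμ) v

theorem spectralApply_eq (h : HasFiniteResolution T s) (φ : ℝ → ℝ) (v : E) :
    spectralApply T φ v = finCalc T s φ v := by
  rw [finCalc_apply]
  refine tsum_eq_sum fun μ hμ => ?_
  change φ μ • eigenProj T μ v = 0
  rw [h.eigenProj_eq_zero hμ, smul_zero]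

theorem finCalc_one (h : HasFiniteResolution T s) (v : E) : finCalc T s (fun _ => 1) v = v := by
  rw [finCalc_apply]; simpa using h.sum_eigenProj v

theorem finCalc_id (h : HasFiniteResolution T s) (v : E) : finCalc T s (fun μ => μ) v = T v := by
  conv_rhs => rw [← h.sum_eigenProj v, map_sum]
  rw [finCalc_apply]
  simp only [apply_eigenProj]

theorem finCalc_finCalc (h : HasFiniteResolution T s) (φ ψ : ℝ → ℝ) (v : E) :
    finCalc T s φ (finCalc T s ψ v) = finCalc T s (fun μ => φ μ * ψ μ) v := by
  simp only [finCalc_apply, map_sum, map_smul]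
  refine Finset.sum_congr rfl fun μ hμ => ?_
  rw [Finset.sum_eq_single μ, eigenProj_eigenProj_self, smul_smul, mul_comm]
  · intro ν _ hν
    rw [eigenProj_eigenProj_of_ne h.symm hν, smul_zero]
  · exact fun hh => absurd hμ hh

theorem norm_sq_finCalc (h : HasFiniteResolution T s) (φ : ℝ → ℝ) (v : E) :
    ‖finCalc T s φ v‖ ^ 2 = ∑ μ ∈ s, φ μ ^ 2 * ‖eigenProj T μ v‖ ^ 2 := by
  rw [finCalc_apply, norm_sq_sum_of_orthogonal fun μ _ ν _ hμν => by
    rw [inner_smul_left, inner_smul_right, inner_eigenProj_eigenProj h.symm hμν, mul_zero,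
      mul_zero]]
  exact Finset.sum_congr rfl fun μ _ => by
    rw [norm_smul, mul_pow, Real.norm_eq_abs, sq_abs]

theorem norm_finCalc_le_of_abs_le (h : HasFiniteResolution T s) {φ ψ : ℝ → ℝ}
    (hφ : ∀ μ ∈ s, |φ μ| ≤ |ψ μ|) (v : E) : ‖finCalc T s φ v‖ ≤ ‖finCalc T s ψ v‖ := by
  apply le_of_sq_le_sq _ (norm_nonneg _)
  rw [h.norm_sq_finCalc, h.norm_sq_finCalc]
  refine Finset.sum_le_sum fun μ hμ => ?_
  exact mul_le_mul_of_nonneg_right (sq_le_sq.2 (hφ μ hμ)) (sq_nonneg _)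

theorem norm_finCalc_le (h : HasFiniteResolution T s) {φ : ℝ → ℝ} {c : ℝ} (hc : 0 ≤ c)
    (hφ : ∀ μ ∈ s, |φ μ| ≤ c) (v : E) : ‖finCalc T s φ v‖ ≤ c * ‖v‖ := by
  have h1 := h.norm_finCalc_le_of_abs_le (ψ := fun _ => c)
    (fun μ hμ => (hφ μ hμ).trans (le_abs_self c)) v
  have h2 : finCalc T s (fun _ => c) v = c • v := by
    conv_rhs => rw [← h.sum_eigenProj v, Finset.smul_sum]
    exact finCalc_apply T s _ v
  rwa [h2, norm_smul, Real.norm_of_nonneg hc] at h1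

theorem inner_finCalc (φ : ℝ → ℝ) (u v : E) :
    inner ℝ (finCalc T s φ u) v = inner ℝ u (finCalc T s φ v) := by
  simp only [finCalc_apply, sum_inner, inner_sum, inner_smul_left, inner_smul_right,
    inner_eigenProj]
  simp

end HasFiniteResolution

/-- A symmetric operator factoring through a finite-dimensional space has a finite spectral
resolution, over its eigenvalues. -/
theorem exists_hasFiniteResolution {n : ℕ} (A : (Fin n → ℝ) →L[ℝ] E) (B : E →L[ℝ] (Fin n → ℝ))
    (hT : ((A ∘L B : E →L[ℝ] E) : E →ₗ[ℝ] E).IsSymmetric) :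
    ∃ s : Finset ℝ, HasFiniteResolution (A ∘L B) s ∧
      ∀ μ ∈ s, ∃ v ≠ 0, (A ∘L B) v = μ • v := by
  set T : E →L[ℝ] E := A ∘L B with hTdef
  have hcomp : IsCompactOperator T :=
    (isCompactOperator_of_locallyCompactSpace_rng A).comp_clm B
  have hfin : {μ : ℝ | Module.End.HasEigenvalue (T : E →ₗ[ℝ] E) μ}.Finite := by
    have h1 : ({μ : ℝ | Module.End.HasEigenvalue (T : E →ₗ[ℝ] E) μ} \ {0}).Finite := by
      set S := {μ : ℝ | Module.End.HasEigenvalue (T : E →ₗ[ℝ] E) μ} \ {0} with hS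
      choose x hx using fun μ : S => (show Module.End.HasEigenvalue (T : E →ₗ[ℝ] E) μ from
        μ.2.1).exists_hasEigenvector
      have hli := Module.End.eigenvectors_linearIndependent (T : E →ₗ[ℝ] E) S x hx
      have hmem : ∀ μ : S, x μ ∈ LinearMap.range (A : (Fin n → ℝ) →ₗ[ℝ] E) := fun μ => by
        have h2 : T (x μ) = (μ : ℝ) • x μ := (hx μ).apply_eq_smul
        have h3 : (μ : ℝ) ≠ 0 := fun h => μ.2.2 h
        refine ⟨(μ : ℝ)⁻¹ • B (x μ), ?_⟩
        have h4 : A (B (x μ)) = (μ : ℝ) • x μ := h2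
        simp [h4, smul_smul, inv_mul_cancel₀ h3]
      have hli' : LinearIndependent ℝ
          (fun μ : S => (⟨x μ, hmem μ⟩ : LinearMap.range (A : (Fin n → ℝ) →ₗ[ℝ] E))) :=
        LinearIndependent.of_comp (LinearMap.range (A : (Fin n → ℝ) →ₗ[ℝ] E)).subtype hli
      have : Finite S := hli'.finite
      exact Set.toFinite S
    exact (h1.union (Set.finite_singleton 0)).subset fun μ hμ => by
      by_cases h : μ = 0
      · exact Or.inr h
      · exact Or.inl ⟨hμ, h⟩
  refine ⟨hfin.toFinset, ⟨hT, fun v => ?_⟩, fun μ hμ => ?_⟩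
  · have hbot := ContinuousLinearMap.orthogonalComplement_iSup_eigenspaces_eq_bot hcomp hT
    have hmem : v - ∑ μ ∈ hfin.toFinset, eigenProj T μ v
        ∈ (⨆ μ, Module.End.eigenspace (T : E →ₗ[ℝ] E) μ)ᗮ := by
      rw [← Submodule.iInf_orthogonal, Submodule.mem_iInf]
      intro μ
      rw [Submodule.mem_orthogonal]
      intro y hy
      have hPy : eigenProj T μ y = y := Submodule.starProjection_eq_self_iff.2 hy
      by_cases hμ : Module.End.HasEigenvalue (T : E →ₗ[ℝ] E) μ
      · rw [inner_sub_right, inner_sum, Finset.sum_eq_single μ, ← inner_eigenProj, hPy, sub_self]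
        · intro ν _ hν
          rw [← hPy, inner_eigenProj_eigenProj hT hν.symm]
        · intro hh
          exact absurd (hfin.mem_toFinset.2 hμ) hh
      · have : Module.End.eigenspace (T : E →ₗ[ℝ] E) μ = ⊥ := by
          by_contra hne
          exact hμ (Module.End.hasEigenvalue_iff.2 hne)
        rw [this, Submodule.mem_bot] at hy
        rw [hy, inner_zero_left]
    rw [hbot, Submodule.mem_bot, sub_eq_zero] at hmem
    exact hmem.symm
  · obtain ⟨v, hv⟩ := (hfin.mem_toFinset.1 hμ).exists_hasEigenvector
    exact ⟨v, hv.2, hv.apply_eq_smul⟩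

end FiniteCalculus

section Interpolation

variable {E : Type*} [NormedAddCommGroup E] [InnerProductSpace ℝ E] {ι κ : Type*}

theorem norm_sum_smul_le_of_orthogonal {S : Finset ι} {p : ι → E}
    (hp : ∀ i ∈ S, ∀ j ∈ S, i ≠ j → inner ℝ (p i) (p j) = 0) {c : ι → ℝ} (hc : ∀ i, |c i| ≤ 1) :
    ‖∑ i ∈ S, c i • p i‖ ≤ ‖∑ i ∈ S, p i‖ := by
  have key : ∀ d : ι → ℝ, ‖∑ i ∈ S, d i • p i‖ ^ 2 = ∑ i ∈ S, d i ^ 2 * ‖p i‖ ^ 2 := fun d => by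
    rw [norm_sq_sum_of_orthogonal fun i hi j hj hij => by
      rw [inner_smul_left, inner_smul_right, hp i hi j hj hij, mul_zero, mul_zero]]
    exact Finset.sum_congr rfl fun i _ => by
      rw [norm_smul, mul_pow, Real.norm_eq_abs, sq_abs]
  apply le_of_sq_le_sq _ (norm_nonneg _)
  have h1 := key fun _ => 1
  simp only [one_smul] at h1
  rw [key, h1]
  refine Finset.sum_le_sum fun i _ => mul_le_mul_of_nonneg_right ?_ (sq_nonneg _)
  rw [one_pow, sq_le_one_iff_abs_le_one]
  exact hc i

/-- Twisting a bilinear form by unimodular factors `exp (I y (v j - u i))` costs a factor `4`: split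
the two exponentials into real and imaginary parts. -/
theorem norm_sum_twist_le {S : Finset ι} {F : Finset κ} {p : ι → E} {q : κ → E}
    (hp : ∀ i ∈ S, ∀ j ∈ S, i ≠ j → inner ℝ (p i) (p j) = 0)
    (hq : ∀ i ∈ F, ∀ j ∈ F, i ≠ j → inner ℝ (q i) (q j) = 0)
    {w : ι → κ → ℝ} {A : ℝ} (hA : 0 ≤ A)
    (hw : ∀ (c : ι → ℝ) (d : κ → ℝ), |∑ i ∈ S, ∑ j ∈ F, c i * d j * w i j|
      ≤ A * (‖∑ i ∈ S, c i • p i‖ * ‖∑ j ∈ F, d j • q j‖))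
    (u : ι → ℝ) (v : κ → ℝ) (y : ℝ) :
    ‖∑ i ∈ S, ∑ j ∈ F, Complex.exp (((y * (v j - u i) : ℝ) : ℂ) * Complex.I) * (w i j : ℂ)‖
      ≤ 4 * A * (‖∑ i ∈ S, p i‖ * ‖∑ j ∈ F, q j‖) := by
  have hb : ∀ (c : ι → ℝ) (d : κ → ℝ), (∀ i, |c i| ≤ 1) → (∀ j, |d j| ≤ 1) →
      |∑ i ∈ S, ∑ j ∈ F, c i * d j * w i j| ≤ A * (‖∑ i ∈ S, p i‖ * ‖∑ j ∈ F, q j‖) := by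
    intro c d hc hd
    refine (hw c d).trans (mul_le_mul_of_nonneg_left ?_ hA)
    exact mul_le_mul (norm_sum_smul_le_of_orthogonal hp hc) (norm_sum_smul_le_of_orthogonal hq hd)
      (norm_nonneg _) (norm_nonneg _)
  have hcos : ∀ x : ℝ, |Real.cos x| ≤ 1 := Real.abs_cos_le_one
  have hsin : ∀ x : ℝ, |Real.sin x| ≤ 1 := Real.abs_sin_le_one
  have h1 := hb (fun i => Real.cos (y * u i)) (fun j => Real.cos (y * v j))
    (fun _ => hcos _) (fun _ => hcos _)
  have h2 := hb (fun i => Real.sin (y * u i)) (fun j => Real.sin (y * v j))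
    (fun _ => hsin _) (fun _ => hsin _)
  have h3 := hb (fun i => Real.cos (y * u i)) (fun j => Real.sin (y * v j))
    (fun _ => hcos _) (fun _ => hsin _)
  have h4 := hb (fun i => Real.sin (y * u i)) (fun j => Real.cos (y * v j))
    (fun _ => hsin _) (fun _ => hcos _)
  set s1 := ∑ i ∈ S, ∑ j ∈ F, Real.cos (y * u i) * Real.cos (y * v j) * w i j
  set s2 := ∑ i ∈ S, ∑ j ∈ F, Real.sin (y * u i) * Real.sin (y * v j) * w i j
  set s3 := ∑ i ∈ S, ∑ j ∈ F, Real.cos (y * u i) * Real.sin (y * v j) * w i j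
  set s4 := ∑ i ∈ S, ∑ j ∈ F, Real.sin (y * u i) * Real.cos (y * v j) * w i j
  have heq : ∑ i ∈ S, ∑ j ∈ F, Complex.exp (((y * (v j - u i) : ℝ) : ℂ) * Complex.I) * (w i j : ℂ)
      = ((s1 + s2 : ℝ) : ℂ) + ((s3 - s4 : ℝ) : ℂ) * Complex.I := by
    simp only [s1, s2, s3, s4, ← Finset.sum_add_distrib, ← Finset.sum_sub_distrib]
    simp only [Complex.ofReal_sum, Finset.sum_mul]
    simp only [← Finset.sum_add_distrib]
    refine Finset.sum_congr rfl fun i _ => Finset.sum_congr rfl fun j _ => ?_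
    rw [Complex.exp_mul_I, ← Complex.ofReal_cos, ← Complex.ofReal_sin, mul_sub, Real.cos_sub,
      Real.sin_sub]
    push_cast
    ring
  rw [heq]
  calc _ ≤ ‖((s1 + s2 : ℝ) : ℂ)‖ + ‖((s3 - s4 : ℝ) : ℂ) * Complex.I‖ := norm_add_le _ _
    _ = |s1 + s2| + |s3 - s4| := by
        rw [norm_mul, Complex.norm_I, mul_one, Complex.norm_real, Complex.norm_real,
          Real.norm_eq_abs, Real.norm_eq_abs]
    _ ≤ (|s1| + |s2|) + (|s3| + |s4|) := add_le_add (abs_add_le _ _) (abs_sub _ _)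
    _ ≤ _ := by linarith

/-- Interpolation by the three lines theorem between the identity and a bilinear form with the
entries `exp (v j - u i) * inner (p i) (q j)`. -/
theorem abs_sum_exp_mul_inner_le {S : Finset ι} {F : Finset κ} {p : ι → E} {q : κ → E}
    (hp : ∀ i ∈ S, ∀ j ∈ S, i ≠ j → inner ℝ (p i) (p j) = 0)
    (hq : ∀ i ∈ F, ∀ j ∈ F, i ≠ j → inner ℝ (q i) (q j) = 0)
    (u : ι → ℝ) (v : κ → ℝ) {A : ℝ} (hA : 1 ≤ A)
    (hw : ∀ (c : ι → ℝ) (d : κ → ℝ),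
      |∑ i ∈ S, ∑ j ∈ F, c i * d j * (Real.exp (v j - u i) * inner ℝ (p i) (q j))|
      ≤ A * (‖∑ i ∈ S, c i • p i‖ * ‖∑ j ∈ F, d j • q j‖))
    {θ : ℝ} (hθ : 0 ≤ θ) (hθ1 : θ ≤ 1) :
    |∑ i ∈ S, ∑ j ∈ F, Real.exp (θ * (v j - u i)) * inner ℝ (p i) (q j)|
      ≤ 4 * A * (‖∑ i ∈ S, p i‖ * ‖∑ j ∈ F, q j‖) := by
  set N := ‖∑ i ∈ S, p i‖ * ‖∑ j ∈ F, q j‖ with hN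
  have hN0 : 0 ≤ N := by positivity
  let f : ℂ → ℂ := fun z => ∑ i ∈ S, ∑ j ∈ F,
    Complex.exp (z * ((v j - u i : ℝ) : ℂ)) * ((inner ℝ (p i) (q j) : ℝ) : ℂ)
  have hd : Differentiable ℂ f := by
    simp only [f]
    fun_prop
  have hB : BddAbove ((norm ∘ f) '' Complex.HadamardThreeLines.verticalClosedStrip 0 1) := by
    refine ⟨∑ i ∈ S, ∑ j ∈ F, Real.exp |v j - u i| * |inner ℝ (p i) (q j)|, ?_⟩
    rintro _ ⟨z, hz, rfl⟩
    have hz' : 0 ≤ z.re ∧ z.re ≤ 1 := hz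
    refine (norm_sum_le _ _).trans (Finset.sum_le_sum fun i _ => (norm_sum_le _ _).trans
      (Finset.sum_le_sum fun j _ => ?_))
    rw [norm_mul, Complex.norm_exp, Complex.norm_real, Real.norm_eq_abs, Complex.re_mul_ofReal]
    gcongr
    calc z.re * (v j - u i) ≤ z.re * |v j - u i| := by gcongr; exacts [hz'.1, le_abs_self _]
      _ ≤ 1 * |v j - u i| := by gcongr; exact hz'.2
      _ = _ := one_mul _
  -- on the line `re z = 0` the form is a unimodular twist of the inner product
  have h0 : ∀ z ∈ Complex.re ⁻¹' {(0 : ℝ)}, ‖f z‖ ≤ 4 * A * N := by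
    intro z hz
    have hz' : z.re = 0 := hz
    have hzI : z = (z.im : ℂ) * Complex.I := by
      apply Complex.ext <;> simp [hz']
    have := norm_sum_twist_le hp hq (w := fun i j => inner ℝ (p i) (q j)) (A := A) (by linarith)
      (fun c d => by
        have h1 : ∑ i ∈ S, ∑ j ∈ F, c i * d j * inner ℝ (p i) (q j)
            = inner ℝ (∑ i ∈ S, c i • p i) (∑ j ∈ F, d j • q j) := by
          rw [sum_inner]
          refine Finset.sum_congr rfl fun i _ => ?_
          rw [inner_sum]
          refine Finset.sum_congr rfl fun j _ => ?_
          rw [inner_smul_left, inner_smul_right]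
          simp; ring
        rw [h1]
        refine (abs_real_inner_le_norm _ _).trans ?_
        exact le_mul_of_one_le_left (by positivity) hA) u v z.im
    refine le_trans (le_of_eq ?_) this
    congr 1
    refine Finset.sum_congr rfl fun i _ => Finset.sum_congr rfl fun j _ => ?_
    congr 2
    conv_lhs => rw [hzI]
    push_cast; ring
  -- on the line `re z = 1` it is a twist of the form bounded by hypothesis
  have h1 : ∀ z ∈ Complex.re ⁻¹' {(1 : ℝ)}, ‖f z‖ ≤ 4 * A * N := by
    intro z hz
    have hz' : z.re = 1 := hz
    have hzI : z = 1 + (z.im : ℂ) * Complex.I := by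
      apply Complex.ext <;> simp [hz']
    have := norm_sum_twist_le hp hq (by linarith) hw u v z.im
    refine le_trans (le_of_eq ?_) this
    congr 1
    refine Finset.sum_congr rfl fun i _ => Finset.sum_congr rfl fun j _ => ?_
    conv_lhs => rw [hzI, add_mul, one_mul, Complex.exp_add, ← Complex.ofReal_exp]
    rw [show ((z.im : ℂ) * Complex.I * ((v j - u i : ℝ) : ℂ))
      = ((z.im * (v j - u i) : ℝ) : ℂ) * Complex.I by push_cast; ring]
    push_cast; ring
  have hz : ((θ : ℝ) : ℂ) ∈ Complex.HadamardThreeLines.verticalClosedStrip 0 1 := by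
    change (θ : ℂ).re ∈ Set.Icc (0 : ℝ) 1
    simpa using ⟨hθ, hθ1⟩
  have hfin := Complex.HadamardThreeLines.norm_le_interp_of_mem_verticalClosedStrip₀₁' f hz
    hd.diffContOnCl hB h0 h1
  have hAN : 0 ≤ 4 * A * N := by positivity
  rw [← Real.rpow_add_of_nonneg hAN (by simpa using hθ1) (by simpa using hθ)] at hfin
  have hf : f (θ : ℂ) = ((∑ i ∈ S, ∑ j ∈ F,
      Real.exp (θ * (v j - u i)) * inner ℝ (p i) (q j) : ℝ) : ℂ) := by
    simp only [f]
    push_cast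
    rfl
  rw [hf, Complex.norm_real, Real.norm_eq_abs] at hfin
  simpa using hfin

end Interpolation

/-! ### The source condition in the reproducing kernel Hilbert space -/

section Source

variable {H G : Type*} [NormedAddCommGroup H] [InnerProductSpace ℝ H] [CompleteSpace H]
  [NormedAddCommGroup G] [InnerProductSpace ℝ G] [CompleteSpace G]

/-- Bessel's inequality for the eigenspaces of a symmetric operator. -/
theorem sum_norm_sq_eigenProj_le {T : H →L[ℝ] H} (hT : (T : H →ₗ[ℝ] H).IsSymmetric)
    (F : Finset ℝ) (u : H) : ∑ t ∈ F, ‖eigenProj T t u‖ ^ 2 ≤ ‖u‖ ^ 2 := by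
  have h1 := norm_sq_sum_of_orthogonal (S := F) (p := fun t => eigenProj T t u)
    fun i _ j _ hij => inner_eigenProj_eigenProj hT hij u u
  have h2 : inner ℝ (∑ t ∈ F, eigenProj T t u) u = ∑ t ∈ F, ‖eigenProj T t u‖ ^ 2 := by
    rw [sum_inner]
    refine Finset.sum_congr rfl fun t _ => ?_
    rw [← real_inner_self_eq_norm_sq, inner_eigenProj, inner_eigenProj, eigenProj_eigenProj_self]
  have h3 := real_inner_le_norm (∑ t ∈ F, eigenProj T t u) u
  rw [h2, ← h1] at h3
  rw [← h1]
  have h4 := norm_nonneg (∑ t ∈ F, eigenProj T t u)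
  have h5 := norm_nonneg u
  nlinarith [sq_nonneg (‖∑ t ∈ F, eigenProj T t u‖ - ‖u‖)]

/-- Transport of a source condition `(J J†)^r u` along an embedding `J : H → G`: it equals `J f`
with `f = ∑ t^s h_t`, where the `h_t` are orthogonal eigenvectors of `J† J`.  A surplus of
smoothness `r - s - 1/2` is absorbed into the `h_t`. -/
theorem exists_eigenvector_expansion (J : H →L[ℝ] G) {U : ℝ} (hU : 0 ≤ U)
    (hJ : ∀ f, ‖J f‖ ≤ √U * ‖f‖) {r s : ℝ} (hs : 0 ≤ s) (hrs : s + 1 / 2 ≤ r) (u : G) :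
    ∃ (f : H) (h : ℝ → H),
      J f = spectralApply (J ∘L ContinuousLinearMap.adjoint J) (fun t => t ^ r) u ∧
      (∀ t, ContinuousLinearMap.adjoint J (J (h t)) = t • h t) ∧
      (∀ t t', t ≠ t' → inner ℝ (h t) (h t') = 0) ∧
      (∀ t, t ≤ 0 → h t = 0) ∧
      HasSum (fun t => t ^ s • h t) f ∧
      ‖f‖ ≤ U ^ s * U ^ (r - s - 1 / 2) * ‖u‖ ∧
      ∀ F : Finset ℝ, ‖∑ t ∈ F, h t‖ ≤ U ^ (r - s - 1 / 2) * ‖u‖ := by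
  set J' := ContinuousLinearMap.adjoint J with hJ'
  set L : G →L[ℝ] G := J ∘L J' with hL
  set T : H →L[ℝ] H := J' ∘L J with hT
  set m : ℝ := r - s - 1 / 2 with hm
  have hm0 : 0 ≤ m := by rw [hm]; linarith
  have hLs : (L : G →ₗ[ℝ] G).IsSymmetric := fun x y => by
    change inner ℝ (J (J' x)) y = inner ℝ x (J (J' y))
    rw [← ContinuousLinearMap.adjoint_inner_right J (J' x) y,
      ← ContinuousLinearMap.adjoint_inner_left J (J' y) x]
  have hTs : (T : H →ₗ[ℝ] H).IsSymmetric := fun x y => by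
    change inner ℝ (J' (J x)) y = inner ℝ x (J' (J y))
    rw [ContinuousLinearMap.adjoint_inner_right, ContinuousLinearMap.adjoint_inner_left]
  have hJ'b : ∀ v, ‖J' v‖ ≤ √U * ‖v‖ := by
    have : ‖J'‖ ≤ √U := by
      rw [hJ', LinearIsometryEquiv.norm_map]
      exact J.opNorm_le_bound (Real.sqrt_nonneg _) hJ
    exact fun v => J'.le_of_opNorm_le this v
  set a : ℝ → G := fun t => eigenProj L t u with ha
  have hLa : ∀ t, J (J' (a t)) = t • a t := fun t => apply_eigenProj L t u
  have hJa : ∀ t, ‖J' (a t)‖ ^ 2 = t * ‖a t‖ ^ 2 := fun t => by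
    rw [← real_inner_self_eq_norm_sq, ContinuousLinearMap.adjoint_inner_left, hLa,
      inner_smul_right, real_inner_self_eq_norm_sq]
  have hneg : ∀ t, t < 0 → a t = 0 := fun t ht => by
    by_contra hne
    have h1 : 0 < ‖a t‖ ^ 2 := by have := norm_pos_iff.2 hne; positivity
    nlinarith [hJa t, sq_nonneg ‖J' (a t)‖]
  have hle : ∀ t, a t ≠ 0 → t ≤ U := fun t hne => by
    have h1 : 0 < ‖a t‖ ^ 2 := by have := norm_pos_iff.2 hne; positivity
    have h2 : ‖J' (a t)‖ ^ 2 ≤ (√U * ‖a t‖) ^ 2 := by gcongr; exact hJ'b _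
    rw [hJa, mul_pow, Real.sq_sqrt hU] at h2
    exact le_of_mul_le_mul_right h2 h1
  -- `(√t)⁻¹ J†` is isometric on the eigenspace of `J J†` for `t`; the square root of a nonpositive
  -- number is `0`, which makes `h t = 0` there
  set h : ℝ → H := fun t => (t ^ m * (√t)⁻¹) • J' (a t) with hh
  have hh0 : ∀ t, t ≤ 0 → h t = 0 := fun t ht => by
    simp [hh, Real.sqrt_eq_zero_of_nonpos ht]
  have hJh : ∀ t, 0 < t → J (h t) = (t ^ m * √t) • a t := fun t ht => by
    have hsq : √t ≠ 0 := (Real.sqrt_pos.2 ht).ne'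
    rw [hh]
    simp only [map_smul, hLa, smul_smul]
    congr 1
    rw [mul_assoc]
    congr 1
    rw [inv_mul_eq_div, Real.div_sqrt]
  have heig : ∀ t, J' (J (h t)) = t • h t := fun t => by
    rcases le_or_gt t 0 with ht | ht
    · simp [hh0 t ht]
    · rw [hJh t ht, map_smul, hh]
      simp only [smul_smul]
      congr 1
      rw [mul_left_comm, ← div_eq_mul_inv, Real.div_sqrt]
  have hortho : ∀ t t', t ≠ t' → inner ℝ (h t) (h t') = 0 := fun t t' hne =>
    hTs.orthogonalFamily_eigenspaces hne ⟨h t, Module.End.mem_eigenspace_iff.2 (heig t)⟩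
      ⟨h t', Module.End.mem_eigenspace_iff.2 (heig t')⟩
  have hnorm : ∀ t, ‖h t‖ ≤ U ^ m * ‖a t‖ := fun t => by
    rcases le_or_gt t 0 with ht | ht
    · rw [hh0 t ht, norm_zero]; positivity
    · by_cases h0 : a t = 0
      · simp [hh, h0]
      · have h1 : ‖J' (a t)‖ = √t * ‖a t‖ := by
          rw [← Real.sqrt_sq (norm_nonneg (J' (a t))), hJa, Real.sqrt_mul ht.le,
            Real.sqrt_sq (norm_nonneg _)]
        have hsq : √t ≠ 0 := (Real.sqrt_pos.2 ht).ne'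
        rw [hh]
        simp only
        rw [norm_smul, h1, Real.norm_of_nonneg (by positivity), mul_assoc, inv_mul_cancel_left₀ hsq]
        gcongr
        exact hle t h0
  have hbess : ∀ F : Finset ℝ, ∑ t ∈ F, ‖a t‖ ^ 2 ≤ ‖u‖ ^ 2 := fun F =>
    sum_norm_sq_eigenProj_le hLs F u
  have hsuma : Summable fun t => ‖a t‖ ^ 2 :=
    summable_of_sum_le (fun t => sq_nonneg _) hbess
  have hts : ∀ t, ‖t ^ s • h t‖ ^ 2 ≤ (U ^ s * U ^ m) ^ 2 * ‖a t‖ ^ 2 := fun t => by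
    rw [← mul_pow]
    rcases le_or_gt t 0 with ht | ht
    · rw [hh0 t ht, smul_zero, norm_zero, zero_pow two_ne_zero]; positivity
    · by_cases h0 : a t = 0
      · simp [hh, h0]
      · rw [norm_smul, Real.norm_of_nonneg (by positivity), mul_assoc]
        gcongr
        · exact hle t h0
        · exact hnorm t
  have hsum : Summable fun t => t ^ s • h t := by
    have h1 := hTs.orthogonalFamily_eigenspaces.summable_iff_norm_sq_summable
      (fun t => (⟨t ^ s • h t, Submodule.smul_mem _ _
        (Module.End.mem_eigenspace_iff.2 (heig t))⟩ :
          Module.End.eigenspace (T : H →ₗ[ℝ] H) t))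
    refine h1.2 ?_
    exact Summable.of_nonneg_of_le (fun t => sq_nonneg _) hts (hsuma.mul_left _)
  refine ⟨∑' t, t ^ s • h t, h, ?_, heig, hortho, hh0, hsum.hasSum, ?_, fun F => ?_⟩
  · rw [J.map_tsum hsum]
    refine tsum_congr fun t => ?_
    change J (t ^ s • h t) = t ^ r • a t
    rcases lt_trichotomy t 0 with ht | rfl | ht
    · rw [hh0 t ht.le, hneg t ht]; simp
    · rw [hh0 0 le_rfl, Real.zero_rpow (show r ≠ 0 by linarith)]; simp
    · rw [map_smul, hJh t ht, smul_smul, Real.sqrt_eq_rpow, ← Real.rpow_add ht, ← Real.rpow_add ht]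
      congr 2
      rw [hm]; ring
  · refine le_of_tendsto hsum.hasSum.norm (Filter.Eventually.of_forall fun F => ?_)
    apply le_of_sq_le_sq _ (by positivity)
    rw [norm_sq_sum_of_orthogonal fun i _ j _ hij => by
      rw [inner_smul_left, inner_smul_right, hortho i j hij, mul_zero, mul_zero], mul_pow]
    refine (Finset.sum_le_sum fun t _ => hts t).trans ?_
    rw [← Finset.mul_sum]
    gcongr
    exact hbess F
  · apply le_of_sq_le_sq _ (by positivity)
    rw [norm_sq_sum_of_orthogonal fun i _ j _ hij => hortho i j hij, mul_pow]
    calc ∑ t ∈ F, ‖h t‖ ^ 2 ≤ ∑ t ∈ F, (U ^ m) ^ 2 * ‖a t‖ ^ 2 := by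
          refine Finset.sum_le_sum fun t _ => ?_
          rw [← mul_pow]
          gcongr
          exact hnorm t
      _ = (U ^ m) ^ 2 * ∑ t ∈ F, ‖a t‖ ^ 2 := by rw [Finset.mul_sum]
      _ ≤ _ := by gcongr; exact hbess F

end Source

/-! ### The deterministic error bound -/

section Deterministic

variable {H G : Type*} [NormedAddCommGroup H] [InnerProductSpace ℝ H] [CompleteSpace H]
  [NormedAddCommGroup G] [InnerProductSpace ℝ G] [CompleteSpace G]

/-- A Cordes-type comparison: if `S` is `ε`-close to `T`, then `(S + lam)^(-s) T^s` has norm at most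
`4 (1 + ε / lam)` for `0 ≤ s ≤ 1`, tested on finite combinations of eigenvectors of `T`. -/
theorem norm_finCalc_rpow_sum_le {S T : H →L[ℝ] H} {σ : Finset ℝ} (hS : HasFiniteResolution S σ)
    (hσ0 : ∀ μ ∈ σ, 0 ≤ μ) {ε lam s : ℝ} (hε0 : 0 ≤ ε) (hlam : 0 < lam)
    (hε : ∀ v, ‖(S - T) v‖ ≤ ε * ‖v‖) (hs0 : 0 ≤ s) (hs1 : s ≤ 1) {h : ℝ → H}
    (heig : ∀ t, T (h t) = t • h t) (hortho : ∀ t t', t ≠ t' → inner ℝ (h t) (h t') = 0)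
    (hneg : ∀ t, t ≤ 0 → h t = 0) (F : Finset ℝ) :
    ‖finCalc S σ (fun μ => (μ + lam) ^ (-s)) (∑ t ∈ F, t ^ s • h t)‖
      ≤ 4 * (1 + ε / lam) * ‖∑ t ∈ F, h t‖ := by
  set k := finCalc S σ (fun μ => (μ + lam) ^ (-s)) (∑ t ∈ F, t ^ s • h t) with hk
  have hpos : ∀ μ ∈ σ, 0 < μ + lam := fun μ hμ => by linarith [hσ0 μ hμ]
  have hA : 1 ≤ 1 + ε / lam := by have := div_nonneg hε0 hlam.le; linarith
  have hmain := abs_sum_exp_mul_inner_le (S := σ) (F := F) (p := fun μ => eigenProj S μ k) (q := h)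
    (fun i _ j _ hij => inner_eigenProj_eigenProj hS.symm hij k k)
    (fun i _ j _ hij => hortho i j hij) (fun μ => Real.log (μ + lam)) Real.log hA
    (fun c d => ?_) hs0 hs1
  · have h1 : ∑ i ∈ σ, ∑ j ∈ F, Real.exp (s * (Real.log j - Real.log (i + lam))) *
        inner ℝ (eigenProj S i k) (h j) = ‖k‖ ^ 2 := by
      rw [← real_inner_self_eq_norm_sq]
      conv_rhs => rw [hk, ← HasFiniteResolution.inner_finCalc]
      rw [← hk, finCalc_apply, sum_inner]
      refine Finset.sum_congr rfl fun i hi => ?_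
      rw [inner_sum]
      refine Finset.sum_congr rfl fun j _ => ?_
      rcases le_or_gt j 0 with hj | hj
      · simp [hneg j hj]
      · rw [inner_smul_left, inner_smul_right, Real.rpow_def_of_pos hj,
          Real.rpow_def_of_pos (hpos i hi), ← mul_assoc]
        congr 1
        simp only [conj_trivial]
        rw [← Real.exp_add]
        congr 1; ring
    rw [h1, abs_of_nonneg (sq_nonneg _), hS.sum_eigenProj, sq] at hmain
    rcases (norm_nonneg k).eq_or_lt with h0 | h0
    · rw [← h0]; positivity
    · refine le_of_mul_le_mul_left ?_ h0
      linarith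
  · set x := finCalc S σ c k with hx
    set y := ∑ j ∈ F, d j • h j with hy
    have hxs : ∑ i ∈ σ, c i • eigenProj S i k = x := (finCalc_apply S σ c k).symm
    set ψ : ℝ → ℝ := fun μ => (μ + lam)⁻¹ with hψ
    have h1 : ∑ i ∈ σ, ∑ j ∈ F, c i * d j * (Real.exp (Real.log j - Real.log (i + lam)) *
        inner ℝ (eigenProj S i k) (h j)) = inner ℝ (finCalc S σ ψ x) (T y) := by
      rw [hx, hS.finCalc_finCalc, finCalc_apply, sum_inner]
      refine Finset.sum_congr rfl fun i hi => ?_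
      rw [hy, map_sum, inner_sum]
      refine Finset.sum_congr rfl fun j _ => ?_
      rcases le_or_gt j 0 with hj | hj
      · simp [hneg j hj]
      · rw [map_smul, heig, inner_smul_left, inner_smul_right, inner_smul_right, Real.exp_sub,
          Real.exp_log hj, Real.exp_log (hpos i hi), hψ]
        simp only [conj_trivial]
        ring
    rw [hxs, h1]
    have h2 : inner ℝ (finCalc S σ ψ x) (T y) = inner ℝ (finCalc S σ (fun μ => μ * ψ μ) x) y
        - inner ℝ (finCalc S σ ψ x) ((S - T) y) := by
      have hsymm : inner ℝ (S (finCalc S σ ψ x)) y = inner ℝ (finCalc S σ ψ x) (S y) :=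
        hS.symm (finCalc S σ ψ x) y
      rw [← hS.finCalc_finCalc (fun μ => μ), hS.finCalc_id, hsymm, ← inner_sub_right]
      simp
    have h3 : ‖finCalc S σ (fun μ => μ * ψ μ) x‖ ≤ 1 * ‖x‖ :=
      hS.norm_finCalc_le zero_le_one (fun μ hμ => by
        have := hpos μ hμ
        rw [hψ, abs_of_nonneg (mul_nonneg (hσ0 μ hμ) (inv_nonneg.2 this.le)), ← div_eq_mul_inv,
          div_le_one this]
        linarith) x
    have h4 : ‖finCalc S σ ψ x‖ ≤ lam⁻¹ * ‖x‖ :=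
      hS.norm_finCalc_le (by positivity) (fun μ hμ => by
        have := hpos μ hμ
        rw [hψ, abs_of_nonneg (inv_nonneg.2 this.le)]
        exact inv_anti₀ hlam (by linarith [hσ0 μ hμ])) x
    rw [h2]
    calc _ ≤ |inner ℝ (finCalc S σ (fun μ => μ * ψ μ) x) y|
          + |inner ℝ (finCalc S σ ψ x) ((S - T) y)| := abs_sub _ _
      _ ≤ ‖finCalc S σ (fun μ => μ * ψ μ) x‖ * ‖y‖ + ‖finCalc S σ ψ x‖ * ‖(S - T) y‖ :=
          add_le_add (abs_real_inner_le_norm _ _) (abs_real_inner_le_norm _ _)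
      _ ≤ (1 * ‖x‖) * ‖y‖ + (lam⁻¹ * ‖x‖) * (ε * ‖y‖) := by
          gcongr
          exact hε y
      _ = _ := by ring

/-- The value of a filter at `0` is irrelevant on vectors orthogonal to the kernel. -/
theorem spectralApply_eq_finCalc_ite {S : H →L[ℝ] H} {σ : Finset ℝ} (hS : HasFiniteResolution S σ)
    (g : ℝ → ℝ) {v : H} (hv : eigenProj S 0 v = 0) :
    spectralApply S g v = finCalc S σ (fun μ => if μ = 0 then 0 else g μ) v := by
  rw [hS.spectralApply_eq, finCalc_apply, finCalc_apply]
  refine Finset.sum_congr rfl fun μ _ => ?_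
  by_cases hμ : μ = 0
  · rw [hμ, hv, smul_zero, smul_zero]
  · simp [hμ]

theorem norm_spectralApply_le {S : H →L[ℝ] H} {σ : Finset ℝ} (hS : HasFiniteResolution S σ)
    {U : ℝ} (hσ0 : ∀ μ ∈ σ, 0 ≤ μ) (hσU : ∀ μ ∈ σ, μ ≤ U) {B : ℝ} (hB : 0 ≤ B) {g : ℝ → ℝ}
    (hg : ∀ μ, 0 < μ → μ ≤ U → |g μ| ≤ B) {v : H} (hv : eigenProj S 0 v = 0) :
    ‖spectralApply S g v‖ ≤ B * ‖v‖ := by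
  rw [spectralApply_eq_finCalc_ite hS g hv]
  refine hS.norm_finCalc_le hB (fun μ hμ => ?_) v
  by_cases h0 : μ = 0
  · simpa [h0] using hB
  · simpa only [h0, if_false] using hg μ (lt_of_le_of_ne (hσ0 μ hμ) (Ne.symm h0)) (hσU μ hμ)

/-- The deterministic error bound.  Apart from the perturbation `ε` of the operator, only the
residual `v - S f` of the equation `S f = v` enters. -/
theorem norm_spectralApply_sub_le (J : H →L[ℝ] G) {S : H →L[ℝ] H} {σ : Finset ℝ}
    (hS : HasFiniteResolution S σ) {U : ℝ} (hσ0 : ∀ μ ∈ σ, 0 ≤ μ) (hσU : ∀ μ ∈ σ, μ ≤ U)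
    {ε lam s b γ : ℝ} (hε0 : 0 ≤ ε) (hlam : 0 < lam)
    (hε : ∀ v, ‖(S - ContinuousLinearMap.adjoint J ∘L J) v‖ ≤ ε * ‖v‖)
    (hs0 : 0 ≤ s) (hs1 : s ≤ 1) (hb : 0 ≤ b) (hγ : 0 ≤ γ) {g : ℝ → ℝ}
    (hg1 : ∀ μ, 0 < μ → μ ≤ U → |g μ| ≤ b / lam) (hg2 : ∀ μ, 0 < μ → μ ≤ U → |g μ * μ| ≤ b)
    (hg3 : ∀ μ, 0 < μ → μ ≤ U → |1 - g μ * μ| * μ ^ (s + 1 / 2) ≤ γ * lam ^ (s + 1 / 2))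
    {f : H} {h : ℝ → H} (heig : ∀ t, ContinuousLinearMap.adjoint J (J (h t)) = t • h t)
    (hortho : ∀ t t', t ≠ t' → inner ℝ (h t) (h t') = 0) (hneg : ∀ t, t ≤ 0 → h t = 0)
    (hf : HasSum (fun t => t ^ s • h t) f) {R : ℝ} (hR : ∀ F : Finset ℝ, ‖∑ t ∈ F, h t‖ ≤ R)
    {v : H} (hv : eigenProj S 0 v = 0) :
    ‖J (spectralApply S g v - f)‖ ≤ (1 + ε / lam) * (2 * b / √lam * ‖v - S f‖
      + 2 ^ (s + 1 / 2) * (1 + b + γ) * lam ^ (s + 1 / 2) * (4 * (1 + ε / lam) * R)) := by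
  set T : H →L[ℝ] H := ContinuousLinearMap.adjoint J ∘L J with hT
  set A : ℝ := 1 + ε / lam with hA
  have hA1 : 1 ≤ A := by have := div_nonneg hε0 hlam.le; linarith
  have hpos : ∀ μ ∈ σ, 0 < μ + lam := fun μ hμ => by linarith [hσ0 μ hμ]
  let g' : ℝ → ℝ := fun μ => if μ = 0 then 0 else g μ
  have hgg : spectralApply S g v = finCalc S σ g' v := spectralApply_eq_finCalc_ite hS g hv
  have hg'1 : ∀ μ ∈ σ, |g' μ| ≤ b / lam := fun μ hμ => by
    by_cases h0 : μ = 0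
    · simp only [g', h0, if_true, abs_zero]; positivity
    · simp only [g', h0, if_false]
      exact hg1 μ (lt_of_le_of_ne (hσ0 μ hμ) (Ne.symm h0)) (hσU μ hμ)
  have hg'2 : ∀ μ ∈ σ, |g' μ * μ| ≤ b := fun μ hμ => by
    by_cases h0 : μ = 0
    · simp only [h0, mul_zero, abs_zero]; exact hb
    · simp only [g', h0, if_false]
      exact hg2 μ (lt_of_le_of_ne (hσ0 μ hμ) (Ne.symm h0)) (hσU μ hμ)
  -- the `L²` norm is controlled by the norm of `(S + lam)^(1/2)`, because `T ≤ S + ε`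
  set w : ℝ → ℝ := fun μ => √(μ + lam) with hw
  set e := spectralApply S g v - f with he
  have he' : e = finCalc S σ g' (v - S f) - finCalc S σ (fun μ => 1 - g' μ * μ) f := by
    have h1 : finCalc S σ (fun μ => 1 - g' μ * μ) f = f - finCalc S σ g' (S f) := by
      have h2 : finCalc S σ (fun μ => 1 - g' μ * μ) f
          = finCalc S σ (fun _ => 1) f - finCalc S σ (fun μ => g' μ * μ) f := by
        simp only [finCalc_apply, ← Finset.sum_sub_distrib]
        exact Finset.sum_congr rfl fun μ _ => sub_smul _ _ _
      rw [h2, hS.finCalc_one, ← hS.finCalc_finCalc g' fun μ => μ, hS.finCalc_id]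
    rw [he, hgg, h1, map_sub]; abel
  have hJe : ‖J e‖ ≤ A * ‖finCalc S σ w e‖ := by
    have h1 : ‖J e‖ ^ 2 = inner ℝ (S e) e - inner ℝ ((S - T) e) e := by
      rw [← inner_sub_left, ← real_inner_self_eq_norm_sq, ← ContinuousLinearMap.adjoint_inner_left]
      simp [hT]
    have h2 : ‖finCalc S σ w e‖ ^ 2 = inner ℝ (S e) e + lam * ‖e‖ ^ 2 := by
      have h3 : inner ℝ (S e) e = ∑ μ ∈ σ, μ * ‖eigenProj S μ e‖ ^ 2 := by
        conv_lhs => rw [← hS.finCalc_id e]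
        rw [finCalc_apply, sum_inner]
        refine Finset.sum_congr rfl fun μ _ => ?_
        rw [inner_smul_left, ← real_inner_self_eq_norm_sq, inner_eigenProj, inner_eigenProj,
          eigenProj_eigenProj_self]
        simp
      have h4 : ‖e‖ ^ 2 = ∑ μ ∈ σ, ‖eigenProj S μ e‖ ^ 2 := by
        have := hS.norm_sq_finCalc (fun _ => 1) e
        rw [hS.finCalc_one] at this
        simpa using this
      rw [hS.norm_sq_finCalc, h3, h4, Finset.mul_sum, ← Finset.sum_add_distrib]
      refine Finset.sum_congr rfl fun μ hμ => ?_
      rw [hw]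
      simp only
      rw [Real.sq_sqrt (hpos μ hμ).le]; ring
    have h5 : |inner ℝ ((S - T) e) e| ≤ ε * ‖e‖ * ‖e‖ :=
      (abs_real_inner_le_norm _ _).trans (by gcongr; exact hε e)
    have h6 : 0 ≤ inner ℝ (S e) e := by
      conv_rhs => rw [← hS.finCalc_id e]
      rw [finCalc_apply, sum_inner]
      refine Finset.sum_nonneg fun μ hμ => ?_
      rw [inner_smul_left, ← eigenProj_eigenProj_self, inner_eigenProj, real_inner_self_eq_norm_sq]
      exact mul_nonneg (hσ0 μ hμ) (sq_nonneg _)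
    apply le_of_sq_le_sq _ (by positivity)
    calc ‖J e‖ ^ 2 ≤ inner ℝ (S e) e + ε * ‖e‖ ^ 2 := by
          rw [h1]; linarith [(abs_le.1 h5).1]
      _ ≤ A * (inner ℝ (S e) e + lam * ‖e‖ ^ 2) := by
          have : A * (lam * ‖e‖ ^ 2) = lam * ‖e‖ ^ 2 + ε * ‖e‖ ^ 2 := by
            rw [hA]; field_simp
          rw [mul_add, this]
          have := mul_nonneg hlam.le (sq_nonneg ‖e‖)
          nlinarith
      _ ≤ A ^ 2 * (inner ℝ (S e) e + lam * ‖e‖ ^ 2) := by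
          have : 0 ≤ inner ℝ (S e) e + lam * ‖e‖ ^ 2 := by positivity
          gcongr
          nlinarith
      _ = _ := by rw [← h2, mul_pow]
  refine hJe.trans (mul_le_mul_of_nonneg_left ?_ (by linarith))
  rw [he', map_sub]
  refine (norm_sub_le _ _).trans (add_le_add ?_ ?_)
  · rw [hS.finCalc_finCalc]
    refine hS.norm_finCalc_le (by positivity) (fun μ hμ => ?_) _
    refine abs_le_of_sq_le_sq ?_ (by positivity)
    rw [mul_pow, hw, Real.sq_sqrt (hpos μ hμ).le, div_pow, Real.sq_sqrt hlam.le]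
    have h1 : μ * g' μ ^ 2 ≤ b * (b / lam) := by
      calc μ * g' μ ^ 2 ≤ |g' μ * μ| * |g' μ| := by
            rw [← abs_mul]
            exact (le_of_eq (by ring)).trans (le_abs_self _)
        _ ≤ _ := mul_le_mul (hg'2 μ hμ) (hg'1 μ hμ) (abs_nonneg _) hb
    have h2 : lam * g' μ ^ 2 ≤ lam * (b / lam) ^ 2 := by
      exact mul_le_mul_of_nonneg_left (sq_le_sq.2 ((hg'1 μ hμ).trans (le_abs_self _))) hlam.le
    have h3 : lam * (b / lam) ^ 2 = b ^ 2 / lam := by field_simp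
    have h4 : b * (b / lam) = b ^ 2 / lam := by ring
    have h5 : 0 ≤ b ^ 2 / lam := by positivity
    have h6 : (2 * b) ^ 2 / lam = 4 * (b ^ 2 / lam) := by ring
    rw [h6, add_mul]
    linarith
  · have hfac : finCalc S σ w (finCalc S σ (fun μ => 1 - g' μ * μ) f)
        = finCalc S σ (fun μ => w μ * (1 - g' μ * μ) * (μ + lam) ^ s)
          (finCalc S σ (fun μ => (μ + lam) ^ (-s)) f) := by
      rw [hS.finCalc_finCalc, hS.finCalc_finCalc, finCalc_apply, finCalc_apply]
      refine Finset.sum_congr rfl fun μ hμ => ?_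
      congr 1
      rw [mul_assoc _ ((μ + lam) ^ s), ← Real.rpow_add (hpos μ hμ), add_neg_cancel,
        Real.rpow_zero, mul_one]
    rw [hfac]
    have hB : ‖finCalc S σ (fun μ => (μ + lam) ^ (-s)) f‖ ≤ 4 * A * R := by
      have hlim := (hf.mapL (finCalc S σ fun μ => (μ + lam) ^ (-s))).norm
      refine le_of_tendsto hlim (Filter.Eventually.of_forall fun F => ?_)
      rw [← map_sum]
      exact (norm_finCalc_rpow_sum_le hS hσ0 hε0 hlam hε hs0 hs1 heig hortho hneg F).trans
        (by gcongr; exact hR F)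
    refine (hS.norm_finCalc_le (c := 2 ^ (s + 1 / 2) * (1 + b + γ) * lam ^ (s + 1 / 2))
      (by positivity) (fun μ hμ => ?_) _).trans (by gcongr)
    have hp := hpos μ hμ
    have hρ : 0 ≤ s + 1 / 2 := by linarith
    have h1 : |w μ * (1 - g' μ * μ) * (μ + lam) ^ s|
        = |1 - g' μ * μ| * (μ + lam) ^ (s + 1 / 2) := by
      rw [hw, abs_mul, abs_mul, abs_of_nonneg (Real.sqrt_nonneg (μ + lam)),
        abs_of_nonneg (Real.rpow_nonneg hp.le s), Real.rpow_add hp, ← Real.sqrt_eq_rpow]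
      ring
    rw [h1]
    have h2 : |1 - g' μ * μ| ≤ 1 + b := by
      calc |1 - g' μ * μ| ≤ |1| + |g' μ * μ| := abs_sub _ _
        _ ≤ 1 + b := by rw [abs_one]; linarith [hg'2 μ hμ]
    rcases le_or_gt μ lam with hle | hgt
    · calc |1 - g' μ * μ| * (μ + lam) ^ (s + 1 / 2)
          ≤ (1 + b + γ) * (2 * lam) ^ (s + 1 / 2) := by
            gcongr
            · linarith
            · linarith
        _ = _ := by rw [Real.mul_rpow (by norm_num) hlam.le]; ring
    · have hμ0 : 0 < μ := hlam.trans hgt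
      have h3 := hg3 μ hμ0 (hσU μ hμ)
      have h4 : g' μ = g μ := by simp [g', hμ0.ne']
      calc |1 - g' μ * μ| * (μ + lam) ^ (s + 1 / 2)
          ≤ |1 - g' μ * μ| * (2 * μ) ^ (s + 1 / 2) := by gcongr; linarith
        _ = 2 ^ (s + 1 / 2) * (|1 - g μ * μ| * μ ^ (s + 1 / 2)) := by
            rw [Real.mul_rpow (by norm_num) hμ0.le, h4]; ring
        _ ≤ 2 ^ (s + 1 / 2) * (γ * lam ^ (s + 1 / 2)) := by gcongr
        _ ≤ 2 ^ (s + 1 / 2) * ((1 + b + γ) * lam ^ (s + 1 / 2)) := by gcongr; linarith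
        _ = _ := by ring

end Deterministic

/-! ### The kernel, its embedding and its empirical operators -/

section Kernel

/-- The kernel section `K(·, x)` as an element of the reproducing kernel Hilbert space. -/
noncomputable def kerSection {X : Type*} (H : Type*) [NormedAddCommGroup H] [InnerProductSpace ℝ H]
    [CompleteSpace H] [RKHS ℝ H X ℝ] (x : X) : H := RKHS.kerFun H x (1 : ℝ)

section Reproducing

variable {X : Type*} {H : Type*} [NormedAddCommGroup H] [InnerProductSpace ℝ H] [CompleteSpace H]
  [RKHS ℝ H X ℝ] {K : X → X → ℝ}

theorem inner_kerSection (f : H) (x : X) : inner ℝ f (kerSection H x) = f x := by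
  simp [kerSection]

theorem inner_kerSection_kerSection (hH : ∀ x y, RKHS.kernel H x y 1 = K x y) (x y : X) :
    inner ℝ (kerSection H x) (kerSection H y) = K y x := by
  rw [inner_kerSection, kerSection, RKHS.kerFun_apply, hH]

theorem norm_sq_kerSection (hH : ∀ x y, RKHS.kernel H x y 1 = K x y) (x : X) :
    ‖kerSection H x‖ ^ 2 = K x x := by
  rw [← real_inner_self_eq_norm_sq, inner_kerSection_kerSection hH]

theorem norm_kerSection_le (hH : ∀ x y, RKHS.kernel H x y 1 = K x y) {U : ℝ}
    (hKU : ∀ x, K x x ≤ U) (x : X) : ‖kerSection H x‖ ≤ √U :=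
  Real.le_sqrt_of_sq_le ((norm_sq_kerSection hH x).trans_le (hKU x))

theorem abs_apply_le (hH : ∀ x y, RKHS.kernel H x y 1 = K x y) {U : ℝ}
    (hKU : ∀ x, K x x ≤ U) (f : H) (x : X) : |f x| ≤ √U * ‖f‖ := by
  rw [← inner_kerSection, mul_comm]
  refine (abs_real_inner_le_norm _ _).trans ?_
  gcongr
  exact norm_kerSection_le hH hKU x

theorem continuous_kerSection [TopologicalSpace X] (hH : ∀ x y, RKHS.kernel H x y 1 = K x y)
    (hK : IsMercerKernel K) : Continuous (kerSection H : X → H) := by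
  rw [continuous_iff_continuousAt]
  intro y
  rw [ContinuousAt, tendsto_iff_dist_tendsto_zero]
  have h1 : ∀ x, dist (kerSection H x) (kerSection H y)
      = √(K x x - 2 * K y x + K y y) := fun x => by
    rw [dist_eq_norm, ← Real.sqrt_sq (norm_nonneg (kerSection H x - kerSection H y)),
      norm_sub_sq_real, norm_sq_kerSection hH, norm_sq_kerSection hH,
      inner_kerSection_kerSection hH]
  simp only [h1]
  have hc := hK.continuous
  have h2 : Continuous fun x => √(K x x - 2 * K y x + K y y) := by
    have e1 : Continuous fun x => K x x := hc.comp (continuous_id.prodMk continuous_id)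
    have e2 : Continuous fun x => K y x := hc.comp (continuous_const.prodMk continuous_id)
    fun_prop
  have h3 := h2.tendsto y
  have h4 : K y y - 2 * K y y + K y y = 0 := by ring
  simpa only [h4, Real.sqrt_zero] using h3

theorem continuous_rkhs_apply [TopologicalSpace X] (hH : ∀ x y, RKHS.kernel H x y 1 = K x y)
    (hK : IsMercerKernel K) (f : H) : Continuous f := by
  have : (f : X → ℝ) = fun x => inner ℝ f (kerSection H x) := by
    funext x; rw [inner_kerSection]
  rw [this]
  exact continuous_const.inner (continuous_kerSection hH hK)

end Reproducing

theorem inner_embedding {X : Type*} [MeasurableSpace X] {H : Type*} [NormedAddCommGroup H]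
    [InnerProductSpace ℝ H] [RKHS ℝ H X ℝ] {μ : Measure X} {J : H →L[ℝ] Lp ℝ 2 μ}
    (hJ : ∀ f, J f =ᵐ[μ] f) (f g : H) :
    inner ℝ (J f) (J g) = ∫ x, f x * g x ∂μ := by
  rw [L2.inner_def]
  refine integral_congr_ae ?_
  filter_upwards [hJ f, hJ g] with x hf hg
  rw [hf, hg]
  simp [mul_comm]

section Embedding

variable {X : Type*} [MetricSpace X] [MeasurableSpace X] [BorelSpace X]
  {H : Type*} [NormedAddCommGroup H] [InnerProductSpace ℝ H] [CompleteSpace H] [RKHS ℝ H X ℝ]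
  {K : X → X → ℝ}

/-- The canonical embedding of the reproducing kernel Hilbert space into `L²`. -/
theorem exists_embedding (hK : IsMercerKernel K) (hH : ∀ x y, RKHS.kernel H x y 1 = K x y) {U : ℝ}
    (hKU : ∀ x, K x x ≤ U) (μ : Measure X) [IsProbabilityMeasure μ] :
    ∃ J : H →L[ℝ] Lp ℝ 2 μ, (∀ f, J f =ᵐ[μ] f) ∧ ∀ f, ‖J f‖ ≤ √U * ‖f‖ := by
  have hmem : ∀ f : H, MemLp f 2 μ := fun f =>
    MemLp.of_bound (continuous_rkhs_apply hH hK f).aestronglyMeasurable (√U * ‖f‖)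
      (Filter.Eventually.of_forall fun x => abs_apply_le hH hKU f x)
  let J₀ : H →ₗ[ℝ] Lp ℝ 2 μ :=
    { toFun := fun f => (hmem f).toLp
      map_add' := fun f g => by
        rw [← MemLp.toLp_add]
        exact MemLp.toLp_congr _ _ (Filter.Eventually.of_forall fun x => by simp)
      map_smul' := fun c f => by
        rw [RingHom.id_apply, ← MemLp.toLp_const_smul]
        exact MemLp.toLp_congr _ _ (Filter.Eventually.of_forall fun x => by simp) }
  have hb : ∀ f, ‖J₀ f‖ ≤ √U * ‖f‖ := fun f => by
    have h3 := Lp.norm_le_of_ae_bound (f := J₀ f) (C := √U * ‖f‖) (by positivity) (by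
      filter_upwards [(hmem f).coeFn_toLp] with x hx
      exact (congrArg norm hx).trans_le (abs_apply_le hH hKU f x))
    have h4 : measureUnivNNReal μ = 1 := by simp [measureUnivNNReal]
    simpa [h4] using h3
  exact ⟨J₀.mkContinuous (√U) hb, fun f => (hmem f).coeFn_toLp, hb⟩

/-- The integral operator factors through the reproducing kernel Hilbert space. -/
theorem embedding_comp_adjoint [CompactSpace X] {μ : Measure X} [IsProbabilityMeasure μ]
    {J : H →L[ℝ] Lp ℝ 2 μ} (hK : IsMercerKernel K) (hH : ∀ x y, RKHS.kernel H x y 1 = K x y)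
    (hJ : ∀ f, J f =ᵐ[μ] f) :
    J ∘L ContinuousLinearMap.adjoint J = integralOperator hK.continuous μ := by
  ext1 u
  apply Lp.ext
  refine (hJ (ContinuousLinearMap.adjoint J u)).trans ?_
  refine Filter.EventuallyEq.trans ?_ (memLp_integral_mul_kernel hK.continuous μ u).coeFn_toLp.symm
  refine Filter.Eventually.of_forall fun s => ?_
  simp only
  rw [← inner_kerSection, ContinuousLinearMap.adjoint_inner_left, L2.inner_def]
  refine integral_congr_ae ?_
  filter_upwards [hJ (kerSection H s)] with x hx
  rw [hx, ← inner_kerSection, inner_kerSection_kerSection hH]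
  simp [mul_comm]

end Embedding

section Empirical

variable {X : Type*} {H : Type*} [NormedAddCommGroup H] [InnerProductSpace ℝ H] [CompleteSpace H]
  [RKHS ℝ H X ℝ] {K : X → X → ℝ} {n : ℕ}

variable (H) in
/-- The weighted empirical operator `S_X^⊤ W S_X`. -/
noncomputable def empiricalOp (x : Fin n → X) (w : Fin n → ℝ) : H →L[ℝ] H :=
  samplingAdj H x ∘L diagOp w ∘L samplingOp H x

theorem samplingAdj_diagOp_apply (x : Fin n → X) (w y : Fin n → ℝ) :
    samplingAdj H x (diagOp w y) = (n : ℝ)⁻¹ • ∑ i, (w i * y i) • kerSection H (x i) := by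
  simp [samplingAdj, diagOp, kerSection]

theorem empiricalOp_apply (x : Fin n → X) (w : Fin n → ℝ) (f : H) :
    empiricalOp H x w f = (n : ℝ)⁻¹ • ∑ i, (w i * f (x i)) • kerSection H (x i) := by
  rw [← samplingAdj_diagOp_apply]
  rfl

theorem inner_samplingAdj_diagOp (x : Fin n → X) (w y : Fin n → ℝ) (g : H) :
    inner ℝ (samplingAdj H x (diagOp w y)) g = (n : ℝ)⁻¹ * ∑ i, w i * y i * g (x i) := by
  rw [samplingAdj_diagOp_apply, inner_smul_left, sum_inner]
  congr 1
  refine Finset.sum_congr rfl fun i _ => ?_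
  rw [inner_smul_left, real_inner_comm, inner_kerSection]
  simp

theorem inner_empiricalOp (x : Fin n → X) (w : Fin n → ℝ) (f g : H) :
    inner ℝ (empiricalOp H x w f) g = (n : ℝ)⁻¹ * ∑ i, w i * f (x i) * g (x i) :=
  inner_samplingAdj_diagOp x w (fun i => f (x i)) g

/-- For weights of mean at most one, the spectrum of the empirical operator lies in the domain
`[0, U]` of the filter. -/
theorem exists_resolution_empiricalOp (hH : ∀ x y, RKHS.kernel H x y 1 = K x y) {U : ℝ}
    (hU : 0 ≤ U) (hKU : ∀ x, K x x ≤ U) (x : Fin n → X) {w : Fin n → ℝ} (hw : ∀ i, 0 ≤ w i)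
    (hw1 : (n : ℝ)⁻¹ * ∑ i, w i ≤ 1) :
    ∃ σ : Finset ℝ, HasFiniteResolution (empiricalOp H x w) σ ∧
      (∀ μ ∈ σ, 0 ≤ μ) ∧ ∀ μ ∈ σ, μ ≤ U := by
  obtain ⟨σ, hσ, hev⟩ := exists_hasFiniteResolution (samplingAdj H x)
    (diagOp w ∘L samplingOp H x) (by
      intro f g
      change inner ℝ (empiricalOp H x w f) g = inner ℝ f (empiricalOp H x w g)
      rw [real_inner_comm (empiricalOp H x w g) f, inner_empiricalOp, inner_empiricalOp]
      congr 1
      exact Finset.sum_congr rfl fun i _ => by ring)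
  have key : ∀ μ ∈ σ, ∃ v : H, 0 < ‖v‖ ^ 2 ∧
      μ * ‖v‖ ^ 2 = (n : ℝ)⁻¹ * ∑ i, w i * v (x i) * v (x i) := fun μ hμ => by
    obtain ⟨v, hv0, hv⟩ := hev μ hμ
    refine ⟨v, by have := norm_pos_iff.2 hv0; positivity, ?_⟩
    rw [← inner_empiricalOp]
    change empiricalOp H x w v = μ • v at hv
    rw [hv, inner_smul_left, real_inner_self_eq_norm_sq]
    simp
  refine ⟨σ, hσ, fun μ hμ => ?_, fun μ hμ => ?_⟩
  · obtain ⟨v, hv, h⟩ := key μ hμ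
    have h1 : 0 ≤ (n : ℝ)⁻¹ * ∑ i, w i * v (x i) * v (x i) := by
      refine mul_nonneg (by positivity) (Finset.sum_nonneg fun i _ => ?_)
      rw [mul_assoc]
      exact mul_nonneg (hw i) (mul_self_nonneg _)
    rw [← h] at h1
    exact nonneg_of_mul_nonneg_left h1 hv
  · obtain ⟨v, hv, h⟩ := key μ hμ
    refine le_of_mul_le_mul_right ?_ hv
    rw [h]
    have h2 : ∀ i, w i * v (x i) * v (x i) ≤ w i * (U * ‖v‖ ^ 2) := fun i => by
      rw [mul_assoc, ← sq]
      refine mul_le_mul_of_nonneg_left ?_ (hw i)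
      have := sq_le_sq' (abs_le.1 (abs_apply_le hH hKU v (x i))).1
        (abs_le.1 (abs_apply_le hH hKU v (x i))).2
      rwa [mul_pow, Real.sq_sqrt hU] at this
    calc (n : ℝ)⁻¹ * ∑ i, w i * v (x i) * v (x i)
        ≤ (n : ℝ)⁻¹ * ∑ i, w i * (U * ‖v‖ ^ 2) :=
          mul_le_mul_of_nonneg_left (Finset.sum_le_sum fun i _ => h2 i) (by positivity)
      _ = ((n : ℝ)⁻¹ * ∑ i, w i) * (U * ‖v‖ ^ 2) := by rw [← Finset.sum_mul]; ring
      _ ≤ 1 * (U * ‖v‖ ^ 2) := by gcongr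
      _ = _ := one_mul _

/-- The right-hand side of the empirical equation is orthogonal to the kernel of the empirical
operator, so the value of a filter at `0` does not matter. -/
theorem eigenProj_zero_samplingAdj [Nonempty (Fin n)] (x : Fin n → X) {w : Fin n → ℝ}
    (hw : ∀ i, 0 ≤ w i) (y : Fin n → ℝ) :
    eigenProj (empiricalOp H x w) 0 (samplingAdj H x (diagOp w y)) = 0 := by
  set v := samplingAdj H x (diagOp w y) with hv
  set k := eigenProj (empiricalOp H x w) 0 v with hk
  have hn : (n : ℝ) ≠ 0 := by
    have := Fin.pos_iff_nonempty.2 ‹_›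
    positivity
  have h0 : ∑ i, w i * k (x i) * k (x i) = 0 := by
    have h1 := inner_empiricalOp x w k k
    rw [hk, apply_eigenProj, zero_smul, inner_zero_left, ← hk] at h1
    exact (mul_eq_zero.1 h1.symm).resolve_left (inv_ne_zero hn)
  have h2 : ∀ i, w i * k (x i) = 0 := fun i => by
    have := (Finset.sum_eq_zero_iff_of_nonneg fun i _ => by
      rw [mul_assoc]; exact mul_nonneg (hw i) (mul_self_nonneg _)).1 h0 i (Finset.mem_univ i)
    rcases mul_eq_zero.1 this with h | h
    · exact h
    · rw [h, mul_zero]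
  rw [← inner_self_eq_zero (𝕜 := ℝ), hk, inner_eigenProj, eigenProj_eigenProj_self, ← hk, hv,
    inner_samplingAdj_diagOp]
  rw [Finset.sum_eq_zero fun i _ => by rw [mul_right_comm, h2, zero_mul], mul_zero]

theorem norm_samplingAdj_diagOp_le (hH : ∀ x y, RKHS.kernel H x y 1 = K x y) {U : ℝ}
    (hKU : ∀ x, K x x ≤ U) (x : Fin n → X) {w : Fin n → ℝ} (hw : ∀ i, 0 ≤ w i)
    (hw1 : (n : ℝ)⁻¹ * ∑ i, w i ≤ 1) {y : Fin n → ℝ} {M : ℝ} (hM : 0 ≤ M) (hy : ∀ i, |y i| ≤ M) :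
    ‖samplingAdj H x (diagOp w y)‖ ≤ M * √U := by
  rw [samplingAdj_diagOp_apply, norm_smul, Real.norm_of_nonneg (by positivity)]
  calc (n : ℝ)⁻¹ * ‖∑ i, (w i * y i) • kerSection H (x i)‖
      ≤ (n : ℝ)⁻¹ * ∑ i, w i * (M * √U) := by
        gcongr
        refine (norm_sum_le _ _).trans (Finset.sum_le_sum fun i _ => ?_)
        rw [norm_smul, Real.norm_eq_abs, abs_mul, abs_of_nonneg (hw i), mul_assoc]
        have := hw i
        gcongr
        · exact hy i
        · exact norm_kerSection_le hH hKU (x i)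
    _ = ((n : ℝ)⁻¹ * ∑ i, w i) * (M * √U) := by rw [← Finset.sum_mul]; ring
    _ ≤ 1 * (M * √U) := by gcongr
    _ = _ := one_mul _

end Empirical

end Kernel

/-! ### Weighted sample means -/

section Sampling

variable {X : Type*} [MeasurableSpace X] {ρ : Kernel X ℝ} [IsMarkovKernel ρ] {ρtr ρte : Measure X}
  [IsProbabilityMeasure ρtr] [IsProbabilityMeasure ρte]

theorem measurePreserving_fst_compProd (ρtr : Measure X) [IsProbabilityMeasure ρtr]
    (ρ : Kernel X ℝ) [IsMarkovKernel ρ] :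
    MeasurePreserving Prod.fst (ρtr.compProd ρ) ρtr :=
  ⟨measurable_fst, Measure.fst_compProd ρtr ρ⟩

theorem integral_comp_fst_compProd {E : Type*} [NormedAddCommGroup E] [NormedSpace ℝ E]
    (ρtr : Measure X) [IsProbabilityMeasure ρtr] (ρ : Kernel X ℝ) [IsMarkovKernel ρ]
    {φ : X → E} (hφ : StronglyMeasurable φ) :
    ∫ z, φ z.1 ∂(ρtr.compProd ρ) = ∫ x, φ x ∂ρtr := by
  have h := integral_map (μ := ρtr.compProd ρ) measurable_fst.aemeasurable (f := φ)
    (by rw [(measurePreserving_fst_compProd ρtr ρ).map_eq]; exact hφ.aestronglyMeasurable)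
  rw [(measurePreserving_fst_compProd ρtr ρ).map_eq] at h
  exact h.symm

/-- The importance weight turns a training average into a test average. -/
theorem integral_weight_smul_compProd {E : Type*} [NormedAddCommGroup E] [NormedSpace ℝ E]
    (hac : ρte.AbsolutelyContinuous ρtr) {φ : X → E} (hφ : StronglyMeasurable φ) :
    ∫ z, weight ρtr ρte z.1 • φ z.1 ∂(ρtr.compProd ρ) = ∫ x, φ x ∂ρte := by
  have h := integral_comp_fst_compProd ρtr ρ
    (φ := fun x => weight ρtr ρte x • φ x) (measurable_weight.stronglyMeasurable.smul hφ)
  exact h.trans (integral_rnDeriv_smul hac)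

/-- The constant in the concentration bounds for weighted sample means. -/
noncomputable def concentrationConst (C σ : ℝ) : ℝ :=
  2 * C * (Real.exp (1 / (2 * C)) * (1 + 1 / (2 * C) + (1 / (2 * C)) ^ 2 * σ ^ 2) + 1)

theorem concentrationConst_pos {C σ : ℝ} (hC : 0 < C) : 0 < concentrationConst C σ := by
  unfold concentrationConst; positivity

theorem one_le_log_twelve_div {δ : ℝ} (hδ : 0 < δ) (hδ1 : δ < 1) : 1 ≤ Real.log (12 / δ) := by
  rw [Real.le_log_iff_exp_le (by positivity)]
  have h1 : Real.exp 1 < 12 := Real.exp_one_lt_d9.trans (by norm_num)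
  have h2 : 12 ≤ 12 / δ := by
    rw [le_div_iff₀ hδ]; linarith
  linarith

/-- Concentration for sample means of variables dominated by the weight.  The confidence `δ / 3`
leaves room for three events. -/
theorem measure_weighted_mean_gt_le {E : Type*} [NormedAddCommGroup E] [InnerProductSpace ℝ E]
    [CompleteSpace E] (hac : ρte.AbsolutelyContinuous ρtr) {α C σ : ℝ} (hα : 0 < α) (hα1 : α ≤ 1)
    (hC : 0 < C) (hw : WeightCondition ρtr ρte α C σ) {ξ : X × ℝ → E} (hξ : StronglyMeasurable ξ)
    {B : ℝ} (hB : 0 < B) (hbd : ∀ᵐ z ∂(ρtr.compProd ρ), ‖ξ z‖ ≤ B * weight ρtr ρte z.1)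
    {n : ℕ} (hn : 1 ≤ n) {δ : ℝ} (hδ : 0 < δ) (hδ1 : δ < 1) :
    Measure.pi (fun _ : Fin n => ρtr.compProd ρ)
      {z | B * (concentrationConst C σ * Real.log (12 / δ) / √n)
        < ‖(n : ℝ)⁻¹ • ∑ i, ξ (z i) - ∫ z, ξ z ∂(ρtr.compProd ρ)‖} ≤ ENNReal.ofReal (δ / 3) := by
  set a : ℝ := 1 / (2 * C) with ha
  set D : ℝ := Real.exp a * (1 + a + a ^ 2 * σ ^ 2) with hD
  have ha0 : 0 < a := by positivity
  have hD0 : 0 ≤ D := by positivity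
  have hexp : ∫⁻ z, ENNReal.ofReal (Real.exp (a * (1 + weight ρtr ρte z.1))) ∂(ρtr.compProd ρ)
      ≤ ENNReal.ofReal D := by
    have hm : Measurable fun x => ENNReal.ofReal (Real.exp (a * (1 + weight ρtr ρte x))) :=
      (Real.measurable_exp.comp
        ((measurable_const.add measurable_weight).const_mul a)).ennreal_ofReal
    rw [(measurePreserving_fst_compProd ρtr ρ).lintegral_comp hm]
    exact lintegral_exp_weight_le hac hα hα1 hC hw
  have hWi : Integrable (fun z : X × ℝ => weight ρtr ρte z.1) (ρtr.compProd ρ) :=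
    (measurePreserving_fst_compProd ρtr ρ).integrable_comp_of_integrable integrable_weight
  have hW1 : ∫ z, weight ρtr ρte z.1 ∂(ρtr.compProd ρ) = 1 := by
    rw [integral_comp_fst_compProd ρtr ρ measurable_weight.stronglyMeasurable, integral_weight hac]
  refine le_trans (measure_mono fun z hz => ?_) (measure_norm_mean_sub_integral_gt_le
    (ρtr.compProd ρ) hξ (fun z => weight_nonneg z.1) hWi hW1 hB ha0 hD0 hbd hexp hn
    (by positivity : 0 < δ / 3))
  rw [Set.mem_ofPred_eq] at hz ⊢
  refine lt_of_le_of_lt ?_ hz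
  have hl := one_le_log_twelve_div hδ hδ1
  have h1 : Real.log (2 / (δ / 3)) ≤ Real.log (12 / δ) := by
    apply Real.log_le_log (by positivity)
    rw [show 2 / (δ / 3) = 6 / δ by field_simp; norm_num]
    gcongr; norm_num
  have h2 : D + Real.log (2 / (δ / 3)) ≤ (D + 1) * Real.log (12 / δ) := by nlinarith
  have h3 : concentrationConst C σ = (D + 1) / a := by
    rw [concentrationConst, ← ha, ← hD, ha]; field_simp
  calc B / a * (D + Real.log (2 / (δ / 3))) / √n
      ≤ B / a * ((D + 1) * Real.log (12 / δ)) / √n := by gcongr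
    _ = _ := by rw [h3]; field_simp

theorem measure_mean_weight_gt_le (hac : ρte.AbsolutelyContinuous ρtr) {α C σ : ℝ} (hα : 0 < α)
    (hα1 : α ≤ 1) (hC : 0 < C) (hw : WeightCondition ρtr ρte α C σ)
    {n : ℕ} (hn : 1 ≤ n) {δ : ℝ} (hδ : 0 < δ) (hδ1 : δ < 1) :
    Measure.pi (fun _ : Fin n => ρtr.compProd ρ)
      {z | concentrationConst C σ * Real.log (12 / δ) / √n
        < |(n : ℝ)⁻¹ * ∑ i, weight ρtr ρte (z i).1 - 1|} ≤ ENNReal.ofReal (δ / 3) := by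
  have h := measure_weighted_mean_gt_le (ρ := ρ) hac hα hα1 hC hw
    (ξ := fun z : X × ℝ => weight ρtr ρte z.1)
    (measurable_weight.comp measurable_fst).stronglyMeasurable one_pos
    (Filter.Eventually.of_forall fun z => by
      rw [one_mul, Real.norm_of_nonneg (weight_nonneg _)]) hn hδ hδ1
  rw [integral_comp_fst_compProd ρtr ρ measurable_weight.stronglyMeasurable, integral_weight hac]
    at h
  simpa only [one_mul, smul_eq_mul, Real.norm_eq_abs] using h

end Sampling

section Events

variable {X : Type*} [MetricSpace X] [CompactSpace X] [MeasurableSpace X] [BorelSpace X]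
  {H : Type*} [NormedAddCommGroup H] [InnerProductSpace ℝ H] [CompleteSpace H] [RKHS ℝ H X ℝ]
  {K : X → X → ℝ} {ρ : Kernel X ℝ} [IsMarkovKernel ρ] {ρtr ρte : Measure X}
  [IsProbabilityMeasure ρtr] [IsProbabilityMeasure ρte]

open scoped TensorProduct in
/-- Concentration of the weighted empirical operator in Hilbert-Schmidt norm: the operator is
encoded by the mean of the rank-one tensors `K_x ⊗ K_x`, in the completed tensor product. -/
theorem measure_empiricalOp_sub_gt_le (hK : IsMercerKernel K)
    (hH : ∀ x y, RKHS.kernel H x y 1 = K x y) {U : ℝ} (hU : 0 < U) (hKU : ∀ x, K x x ≤ U)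
    {J : H →L[ℝ] Lp ℝ 2 ρte} (hJ : ∀ f, J f =ᵐ[ρte] f)
    (hac : ρte.AbsolutelyContinuous ρtr) {α C σ : ℝ} (hα : 0 < α) (hα1 : α ≤ 1)
    (hC : 0 < C) (hw : WeightCondition ρtr ρte α C σ)
    {n : ℕ} (hn : 1 ≤ n) {δ : ℝ} (hδ : 0 < δ) (hδ1 : δ < 1) :
    Measure.pi (fun _ : Fin n => ρtr.compProd ρ)
      {z | ¬ ∀ f : H, ‖(empiricalOp H (fun i => (z i).1) (fun i => weight ρtr ρte (z i).1)
          - ContinuousLinearMap.adjoint J ∘L J) f‖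
        ≤ U * (concentrationConst C σ * Real.log (12 / δ) / √n) * ‖f‖}
      ≤ ENNReal.ofReal (δ / 3) := by
  let ι : H ⊗[ℝ] H → UniformSpace.Completion (H ⊗[ℝ] H) := fun v => v
  let φ : X → UniformSpace.Completion (H ⊗[ℝ] H) :=
    fun x => ι (kerSection H x ⊗ₜ[ℝ] kerSection H x)
  have hφc : Continuous φ :=
    (UniformSpace.Completion.continuous_coe _).comp
      (TensorProduct.continuous_tmul.comp
        ((continuous_kerSection hH hK).prodMk (continuous_kerSection hH hK)))
  have hφm : StronglyMeasurable φ := hφc.stronglyMeasurable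
  have hφb : ∀ x, ‖φ x‖ ≤ U := fun x => by
    have h1 : ‖φ x‖ = ‖kerSection H x‖ * ‖kerSection H x‖ := by
      simp [φ, ι, UniformSpace.Completion.norm_coe]
    rw [h1, ← sq, norm_sq_kerSection hH]
    exact hKU x
  have hφi : ∀ (f g : H) (x : X), inner ℝ (ι (f ⊗ₜ[ℝ] g)) (φ x) = f x * g x := fun f g x => by
    simp only [φ, ι, UniformSpace.Completion.inner_coe, TensorProduct.inner_tmul,
      inner_kerSection]
  let ξ : X × ℝ → UniformSpace.Completion (H ⊗[ℝ] H) := fun z => weight ρtr ρte z.1 • φ z.1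
  have hξm : StronglyMeasurable ξ :=
    (measurable_weight.stronglyMeasurable.smul hφm).comp_measurable measurable_fst
  have hξb : ∀ z, ‖ξ z‖ ≤ U * weight ρtr ρte z.1 := fun z => by
    rw [norm_smul, Real.norm_of_nonneg (weight_nonneg _), mul_comm]
    exact mul_le_mul_of_nonneg_right (hφb _) (weight_nonneg _)
  refine le_trans (measure_mono fun z hz => ?_) (measure_weighted_mean_gt_le (ρ := ρ) hac hα hα1 hC
    hw hξm hU (Filter.Eventually.of_forall hξb) hn hδ hδ1)
  by_contra hnot
  refine hz fun f => ?_
  have hle : ‖(n : ℝ)⁻¹ • ∑ i, ξ (z i) - ∫ z, ξ z ∂(ρtr.compProd ρ)‖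
      ≤ U * (concentrationConst C σ * Real.log (12 / δ) / √n) := not_lt.1 hnot
  set τ := U * (concentrationConst C σ * Real.log (12 / δ) / √n)
  set A := empiricalOp H (fun i => (z i).1) (fun i => weight ρtr ρte (z i).1)
    - ContinuousLinearMap.adjoint J ∘L J with hA
  have hmean : ∫ z, ξ z ∂(ρtr.compProd ρ) = ∫ x, φ x ∂ρte := integral_weight_smul_compProd hac hφm
  have hφint : Integrable φ ρte :=
    Integrable.of_bound hφm.aestronglyMeasurable U (Filter.Eventually.of_forall hφb)
  have hin : ∀ g : H, inner ℝ (A f) g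
      = inner ℝ (ι (f ⊗ₜ[ℝ] g))
        ((n : ℝ)⁻¹ • ∑ i, ξ (z i) - ∫ z, ξ z ∂(ρtr.compProd ρ)) := fun g => by
    rw [hA, sub_apply, inner_sub_left, inner_empiricalOp,
      ContinuousLinearMap.comp_apply, ContinuousLinearMap.adjoint_inner_left, inner_embedding hJ,
      inner_sub_right, inner_smul_right, inner_sum, hmean, ← integral_inner hφint]
    simp only [ξ, inner_smul_right, hφi, mul_assoc]
  have h1 : ‖A f‖ * ‖A f‖ ≤ τ * ‖f‖ * ‖A f‖ := by
    rw [← real_inner_self_eq_norm_mul_norm, hin]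
    refine (real_inner_le_norm _ _).trans ?_
    have h2 : ‖ι (f ⊗ₜ[ℝ] A f)‖ = ‖f‖ * ‖A f‖ := by
      simp [ι, UniformSpace.Completion.norm_coe]
    rw [h2, mul_comm, ← mul_assoc]
    gcongr
  rcases (norm_nonneg (A f)).eq_or_lt with h0 | h0
  · rw [← h0]
    have : 0 ≤ τ := (norm_nonneg _).trans hle
    positivity
  · exact le_of_mul_le_mul_right h1 h0

/-- The noise `w (y - f(x)) K_x` is centred when `f` represents the regression function on the test
distribution. -/
theorem integral_noise_eq_zero (hac : ρte.AbsolutelyContinuous ρtr) {M : ℝ}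
    (hM : ∀ᵐ z ∂(ρtr.compProd ρ), |z.2| ≤ M) {f : H} (hf : regressionFunction ρ =ᵐ[ρte] f)
    (hint : Integrable (fun z : X × ℝ => (weight ρtr ρte z.1 * (z.2 - f z.1)) • kerSection H z.1)
      (ρtr.compProd ρ)) :
    ∫ z, (weight ρtr ρte z.1 * (z.2 - f z.1)) • kerSection H z.1 ∂(ρtr.compProd ρ) = 0 := by
  rw [Measure.integral_compProd hint]
  have h1 : ∀ᵐ x ∂ρtr, ∫ y, (weight ρtr ρte x * (y - f x)) • kerSection H x ∂(ρ x)
      = weight ρtr ρte x • ((regressionFunction ρ x - f x) • kerSection H x) := by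
    filter_upwards [Measure.ae_ae_of_ae_compProd hM] with x hx
    have hy : Integrable (fun y : ℝ => y) (ρ x) :=
      Integrable.of_bound measurable_id.aestronglyMeasurable M hx
    rw [integral_smul_const, integral_const_mul, integral_sub hy (integrable_const _), smul_smul]
    simp [regressionFunction]
  rw [integral_congr_ae h1]
  have h2 : ∫ x, weight ρtr ρte x • ((regressionFunction ρ x - f x) • kerSection H x) ∂ρtr
      = ∫ x, (regressionFunction ρ x - f x) • kerSection H x ∂ρte := integral_rnDeriv_smul hac
  rw [h2, ← integral_zero X H (μ := ρte)]
  refine integral_congr_ae ?_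
  filter_upwards [hf] with x hx
  rw [hx, sub_self, zero_smul]

theorem measure_noise_gt_le (hK : IsMercerKernel K) (hH : ∀ x y, RKHS.kernel H x y 1 = K x y)
    {U : ℝ} (hKU : ∀ x, K x x ≤ U)
    (hac : ρte.AbsolutelyContinuous ρtr) {α C σ : ℝ} (hα : 0 < α) (hα1 : α ≤ 1)
    (hC : 0 < C) (hw : WeightCondition ρtr ρte α C σ)
    {M : ℝ} (hM : ∀ᵐ z ∂(ρtr.compProd ρ), |z.2| ≤ M) {f : H}
    (hf : regressionFunction ρ =ᵐ[ρte] f) {B : ℝ} (hB : 0 < B) (hB' : (M + √U * ‖f‖) * √U ≤ B)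
    {n : ℕ} (hn : 1 ≤ n) {δ : ℝ} (hδ : 0 < δ) (hδ1 : δ < 1) :
    Measure.pi (fun _ : Fin n => ρtr.compProd ρ)
      {z | B * (concentrationConst C σ * Real.log (12 / δ) / √n)
        < ‖(n : ℝ)⁻¹ • ∑ i, (weight ρtr ρte (z i).1 * ((z i).2 - f (z i).1)) •
          kerSection H (z i).1‖} ≤ ENNReal.ofReal (δ / 3) := by
  have hξm : StronglyMeasurable fun z : X × ℝ =>
      (weight ρtr ρte z.1 * (z.2 - f z.1)) • kerSection H z.1 := by
    have hfm : Measurable f := (continuous_rkhs_apply hH hK f).measurable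
    have hks : StronglyMeasurable (kerSection H : X → H) :=
      (continuous_kerSection hH hK).stronglyMeasurable
    refine StronglyMeasurable.smul ?_ (hks.comp_measurable measurable_fst)
    exact ((measurable_weight.comp measurable_fst).mul
      (measurable_snd.sub (hfm.comp measurable_fst))).stronglyMeasurable
  have hξb : ∀ᵐ z ∂(ρtr.compProd ρ), ‖(weight ρtr ρte z.1 * (z.2 - f z.1)) • kerSection H z.1‖
      ≤ B * weight ρtr ρte z.1 := by
    filter_upwards [hM] with z hz
    rw [norm_smul, norm_mul, Real.norm_of_nonneg (weight_nonneg _), mul_assoc, mul_comm]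
    refine mul_le_mul_of_nonneg_right (le_trans ?_ hB') (weight_nonneg _)
    have h1 : ‖z.2 - f z.1‖ ≤ M + √U * ‖f‖ :=
      (norm_sub_le _ _).trans (add_le_add hz (abs_apply_le hH hKU f z.1))
    exact mul_le_mul h1 (norm_kerSection_le hH hKU z.1) (norm_nonneg _)
      ((norm_nonneg _).trans h1)
  have hWi : Integrable (fun z : X × ℝ => weight ρtr ρte z.1) (ρtr.compProd ρ) :=
    (measurePreserving_fst_compProd ρtr ρ).integrable_comp_of_integrable integrable_weight
  have hint := (hWi.const_mul B).mono' hξm.aestronglyMeasurable hξb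
  have h := measure_weighted_mean_gt_le hac hα hα1 hC hw hξm hB hξb hn hδ hδ1
  rw [integral_noise_eq_zero hac hM hf hint] at h
  simpa only [sub_zero] using h

end Events

/-! ### Error on typical and untypical samples, and the rate -/

section GoodSample

variable {X : Type*} {H G : Type*} [NormedAddCommGroup H] [InnerProductSpace ℝ H] [CompleteSpace H]
  [RKHS ℝ H X ℝ] [NormedAddCommGroup G] [InnerProductSpace ℝ G]
  {K : X → X → ℝ} {n : ℕ}

theorem normalized_nonneg {w : Fin n → ℝ} (hw : ∀ i, 0 ≤ w i) (i : Fin n) :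
    0 ≤ w i / ((n : ℝ)⁻¹ * ∑ j, w j) :=
  div_nonneg (hw i) (mul_nonneg (by positivity) (Finset.sum_nonneg fun j _ => hw j))

theorem mean_normalized_le_one (w : Fin n → ℝ) :
    (n : ℝ)⁻¹ * ∑ i, w i / ((n : ℝ)⁻¹ * ∑ j, w j) ≤ 1 := by
  rw [← Finset.sum_div, ← mul_div_assoc]
  exact div_self_le_one _

/-- A crude bound that holds for every sample; it is used when the sample is so untypical that the
mean of the weights may be far from one. -/
theorem norm_embedding_estimator_sub_le (hH : ∀ x y, RKHS.kernel H x y 1 = K x y) {U : ℝ}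
    (hU : 0 ≤ U) (hKU : ∀ x, K x x ≤ U) {J : H →L[ℝ] G} (hJ : ∀ f, ‖J f‖ ≤ √U * ‖f‖)
    [Nonempty (Fin n)] (x : Fin n → X) {w y : Fin n → ℝ} (hw : ∀ i, 0 ≤ w i)
    (hw1 : (n : ℝ)⁻¹ * ∑ i, w i ≤ 1) {M : ℝ} (hM : 0 ≤ M) (hy : ∀ i, |y i| ≤ M)
    {b lam : ℝ} (hb : 0 ≤ b) (hlam : 0 < lam) {g : ℝ → ℝ}
    (hg1 : ∀ μ, 0 < μ → μ ≤ U → |g μ| ≤ b / lam) (f : H) :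
    ‖J (spectralEstimator H g x w y - f)‖ ≤ √U * (b / lam * (M * √U) + ‖f‖) := by
  obtain ⟨σ, hσ, hσ0, hσU⟩ := exists_resolution_empiricalOp hH hU hKU x hw hw1
  have h1 : ‖spectralEstimator H g x w y‖ ≤ b / lam * ‖samplingAdj H x (diagOp w y)‖ :=
    norm_spectralApply_le hσ hσ0 hσU (by positivity) hg1 (eigenProj_zero_samplingAdj x hw y)
  have h2 := norm_samplingAdj_diagOp_le hH hKU x hw hw1 hM hy
  refine (hJ _).trans (mul_le_mul_of_nonneg_left ?_ (Real.sqrt_nonneg _))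
  refine (norm_sub_le _ _).trans (add_le_add_left (h1.trans ?_) _)
  gcongr

/-- The error on a typical sample: normalizing by the mean weight `m` with `|m - 1| ≤ η ≤ 1/2`
changes the weighted empirical operator and the residual only by constant factors. -/
theorem norm_embedding_normalized_sub_le [CompleteSpace G]
    (hH : ∀ x y, RKHS.kernel H x y 1 = K x y) {U : ℝ}
    (hU : 0 ≤ U) (hKU : ∀ x, K x x ≤ U) {J : H →L[ℝ] G} (hJ : ∀ f, ‖J f‖ ≤ √U * ‖f‖)
    [Nonempty (Fin n)] (x : Fin n → X) {w y : Fin n → ℝ} (hw : ∀ i, 0 ≤ w i)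
    {η B : ℝ} (hη0 : 0 ≤ η) (hη : η ≤ 1 / 2) (hm : |(n : ℝ)⁻¹ * ∑ i, w i - 1| ≤ η)
    (hop : ∀ v, ‖(empiricalOp H x w - ContinuousLinearMap.adjoint J ∘L J) v‖ ≤ U * η * ‖v‖)
    {lam s b γ : ℝ} (hlam : 0 < lam) (hs0 : 0 ≤ s) (hs1 : s ≤ 1) (hb : 0 ≤ b) (hγ : 0 ≤ γ)
    {g : ℝ → ℝ}
    (hg1 : ∀ μ, 0 < μ → μ ≤ U → |g μ| ≤ b / lam) (hg2 : ∀ μ, 0 < μ → μ ≤ U → |g μ * μ| ≤ b)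
    (hg3 : ∀ μ, 0 < μ → μ ≤ U → |1 - g μ * μ| * μ ^ (s + 1 / 2) ≤ γ * lam ^ (s + 1 / 2))
    {f : H} {h : ℝ → H} (heig : ∀ t, ContinuousLinearMap.adjoint J (J (h t)) = t • h t)
    (hortho : ∀ t t', t ≠ t' → inner ℝ (h t) (h t') = 0) (hneg : ∀ t, t ≤ 0 → h t = 0)
    (hf : HasSum (fun t => t ^ s • h t) f) {R : ℝ} (hR : ∀ F : Finset ℝ, ‖∑ t ∈ F, h t‖ ≤ R)
    (hnoise : ‖(n : ℝ)⁻¹ • ∑ i, (w i * (y i - f (x i))) • kerSection H (x i)‖ ≤ B * η) :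
    ‖J (spectralEstimator H g x (fun i => w i / ((n : ℝ)⁻¹ * ∑ j, w j)) y - f)‖
      ≤ (1 + 4 * U * η / lam) * (2 * b / √lam * (2 * (B * η))
        + 2 ^ (s + 1 / 2) * (1 + b + γ) * lam ^ (s + 1 / 2) *
          (4 * (1 + 4 * U * η / lam) * R)) := by
  set m : ℝ := (n : ℝ)⁻¹ * ∑ j, w j with hmdef
  set w' : Fin n → ℝ := fun i => w i / m with hw'
  have hm2 : 1 / 2 ≤ m := by linarith [(abs_le.1 hm).1]
  have hm0 : 0 < m := by linarith
  have hminv : m⁻¹ ≤ 2 := by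
    rw [inv_le_comm₀ hm0 two_pos]; linarith
  have hw'0 : ∀ i, 0 ≤ w' i := normalized_nonneg hw
  obtain ⟨σ, hσ, hσ0, hσU⟩ := exists_resolution_empiricalOp hH hU hKU x hw'0
    (mean_normalized_le_one w)
  set T : H →L[ℝ] H := ContinuousLinearMap.adjoint J ∘L J with hT
  have hTb : ∀ v, ‖T v‖ ≤ U * ‖v‖ := fun v => by
    have h1 : ‖ContinuousLinearMap.adjoint J‖ ≤ √U := by
      rw [LinearIsometryEquiv.norm_map]
      exact J.opNorm_le_bound (Real.sqrt_nonneg _) hJ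
    calc ‖T v‖ ≤ √U * ‖J v‖ := (ContinuousLinearMap.adjoint J).le_of_opNorm_le h1 _
      _ ≤ √U * (√U * ‖v‖) := by gcongr; exact hJ v
      _ = U * ‖v‖ := by rw [← mul_assoc, Real.mul_self_sqrt hU]
  have hscale : ∀ v, empiricalOp H x w' v = m⁻¹ • empiricalOp H x w v := fun v => by
    have h1 : ∑ i, (w' i * v (x i)) • kerSection H (x i)
        = m⁻¹ • ∑ i, (w i * v (x i)) • kerSection H (x i) := by
      rw [Finset.smul_sum]
      refine Finset.sum_congr rfl fun i _ => ?_
      rw [smul_smul]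
      congr 1
      rw [hw']; ring
    rw [empiricalOp_apply, empiricalOp_apply, h1, smul_comm]
  have hε : ∀ v, ‖(empiricalOp H x w' - T) v‖ ≤ 4 * U * η * ‖v‖ := fun v => by
    have h1 : (empiricalOp H x w' - T) v
        = m⁻¹ • (empiricalOp H x w - T) v + (m⁻¹ - 1) • T v := by
      rw [sub_apply, sub_apply, hscale]
      module
    have h2 : |m⁻¹ - 1| ≤ 2 * η := by
      have h3 : m⁻¹ - 1 = m⁻¹ * -(m - 1) := by field_simp; ring
      rw [h3, abs_mul, abs_neg, abs_of_pos (inv_pos.2 hm0)]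
      exact mul_le_mul hminv hm (abs_nonneg _) two_pos.le
    rw [h1]
    refine (norm_add_le _ _).trans ?_
    rw [norm_smul, norm_smul, Real.norm_of_nonneg (inv_nonneg.2 hm0.le), Real.norm_eq_abs]
    calc m⁻¹ * ‖(empiricalOp H x w - T) v‖ + |m⁻¹ - 1| * ‖T v‖
        ≤ 2 * (U * η * ‖v‖) + 2 * η * (U * ‖v‖) := by
          gcongr
          · exact hop v
          · exact hTb v
      _ = _ := by ring
  have hres : ‖samplingAdj H x (diagOp w' y) - empiricalOp H x w' f‖ ≤ 2 * (B * η) := by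
    have h1 : samplingAdj H x (diagOp w' y) - empiricalOp H x w' f
        = m⁻¹ • ((n : ℝ)⁻¹ • ∑ i, (w i * (y i - f (x i))) • kerSection H (x i)) := by
      have h2 : ∑ i, (w' i * y i) • kerSection H (x i) - ∑ i, (w' i * f (x i)) • kerSection H (x i)
          = m⁻¹ • ∑ i, (w i * (y i - f (x i))) • kerSection H (x i) := by
        rw [Finset.smul_sum, ← Finset.sum_sub_distrib]
        refine Finset.sum_congr rfl fun i _ => ?_
        rw [smul_smul, ← sub_smul]
        congr 1
        rw [hw']; ring
      rw [samplingAdj_diagOp_apply, empiricalOp_apply, ← smul_sub, h2, smul_comm]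
    rw [h1, norm_smul, Real.norm_of_nonneg (inv_nonneg.2 hm0.le)]
    exact mul_le_mul hminv hnoise (norm_nonneg _) two_pos.le
  have hmain := norm_spectralApply_sub_le J hσ hσ0 hσU (by positivity) hlam hε hs0 hs1 hb hγ hg1 hg2
    hg3 heig hortho hneg hf hR (eigenProj_zero_samplingAdj x hw'0 y)
  refine hmain.trans ?_
  gcongr

end GoodSample

section Rate

/-- The final rate bookkeeping: `lam ^ ρ` is the target rate for `lam = n ^ (-1 / (2 ρ + 1))`. -/
theorem regularization_facts {n : ℕ} (hn : 1 ≤ n) {ρ : ℝ} (hρ : 1 / 2 ≤ ρ) {lam : ℝ}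
    (hlam : lam = (n : ℝ) ^ (-(1 / (2 * ρ + 1)))) :
    0 < lam ∧ lam ≤ 1 ∧ (lam * √n)⁻¹ ≤ 1 ∧ (√lam * √n)⁻¹ = lam ^ ρ ∧ lam⁻¹ ≤ lam ^ ρ * n ∧
      lam ^ ρ = (n : ℝ) ^ (-(ρ / (2 * ρ + 1))) := by
  have hn1 : (1 : ℝ) ≤ n := by exact_mod_cast hn
  have hn0 : (0 : ℝ) < n := by linarith
  have hd : 0 < 2 * ρ + 1 := by linarith
  have hlam0 : 0 < lam := by rw [hlam]; positivity
  have hpow : ∀ e : ℝ, lam ^ e = (n : ℝ) ^ (-(1 / (2 * ρ + 1)) * e) := fun e => by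
    rw [hlam, ← Real.rpow_mul hn0.le]
  have hinv : lam⁻¹ = (n : ℝ) ^ (1 / (2 * ρ + 1)) := by
    rw [hlam, Real.rpow_neg hn0.le, inv_inv]
  refine ⟨hlam0, ?_, ?_, ?_, ?_, ?_⟩
  · rw [hlam]
    refine Real.rpow_le_one_of_one_le_of_nonpos hn1 ?_
    have : 0 ≤ 1 / (2 * ρ + 1) := by positivity
    linarith
  · rw [mul_inv, hinv, Real.sqrt_eq_rpow, ← Real.rpow_neg hn0.le, ← Real.rpow_add hn0]
    refine Real.rpow_le_one_of_one_le_of_nonpos hn1 ?_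
    have : 1 / (2 * ρ + 1) ≤ 1 / 2 := by
      apply one_div_le_one_div_of_le two_pos; linarith
    linarith
  · rw [Real.sqrt_eq_rpow, Real.sqrt_eq_rpow, hpow, hpow, ← Real.rpow_add hn0,
      ← Real.rpow_neg hn0.le]
    congr 1
    field_simp; ring
  · rw [hinv, hpow]
    nth_rewrite 3 [← Real.rpow_one (n : ℝ)]
    rw [← Real.rpow_add hn0]
    refine Real.rpow_le_rpow_of_exponent_le hn1 ?_
    rw [← sub_nonneg]
    have : -(1 / (2 * ρ + 1)) * ρ + 1 - 1 / (2 * ρ + 1) = ρ / (2 * ρ + 1) := by field_simp; ring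
    rw [this]; positivity
  · rw [hpow]; congr 1; ring

/-- On typical samples the error is of the target order, up to a power of `ell`. -/
theorem typical_error_le {U c b B R γ q lam ρ ell sn : ℝ} (hU : 0 ≤ U) (hc : 0 ≤ c) (hb : 0 ≤ b)
    (hB : 0 ≤ B) (hR : 0 ≤ R) (hγ : 0 ≤ γ) (hq : 0 ≤ q) (hell : 1 ≤ ell) (hlam : 0 < lam)
    (hsn : 0 ≤ sn) (h1 : (lam * sn)⁻¹ ≤ 1) (h2 : (√lam * sn)⁻¹ = lam ^ ρ) :
    (1 + 4 * U * (c * ell / sn) / lam) * (2 * b / √lam * (2 * (B * (c * ell / sn)))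
        + q * (1 + b + γ) * lam ^ ρ * (4 * (1 + 4 * U * (c * ell / sn) / lam) * R))
      ≤ (1 + 4 * U * c) * (4 * b * B * c + q * (1 + b + γ) * (4 * (1 + 4 * U * c) * R))
        * lam ^ ρ * ell ^ 3 := by
  set A₀ : ℝ := 1 + 4 * U * c with hA₀
  have hA₀0 : 0 ≤ A₀ := by positivity
  have hpow : 0 ≤ lam ^ ρ := by positivity
  have e1 : 4 * U * (c * ell / sn) / lam = 4 * U * c * ell * (lam * sn)⁻¹ := by
    rw [mul_inv, div_eq_mul_inv, div_eq_mul_inv]; ring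
  have e2 : 2 * b / √lam * (2 * (B * (c * ell / sn))) = 4 * b * B * c * ell * lam ^ ρ := by
    rw [← h2, mul_inv, div_eq_mul_inv, div_eq_mul_inv]; ring
  have hA : 1 + 4 * U * (c * ell / sn) / lam ≤ A₀ * ell := by
    rw [e1, hA₀]
    have : 4 * U * c * ell * (lam * sn)⁻¹ ≤ 4 * U * c * ell * 1 := by gcongr
    linarith
  rw [e2]
  calc _ ≤ A₀ * ell * (4 * b * B * c * ell * lam ^ ρ
          + q * (1 + b + γ) * lam ^ ρ * (4 * (A₀ * ell) * R)) := by gcongr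
    _ = A₀ * (4 * b * B * c + q * (1 + b + γ) * (4 * A₀ * R)) * lam ^ ρ * ell ^ 2 := by ring
    _ ≤ _ := by
        refine mul_le_mul_of_nonneg_left (pow_le_pow_right₀ hell (by norm_num)) (by positivity)

/-- On untypical samples `√n` is at most a multiple of `ell`, so a polynomial loss in `n` is
affordable. -/
theorem untypical_error_le {n c ell lam ρ Q N : ℝ} (hn : 0 ≤ n) (hell : 1 ≤ ell)
    (hlam : 0 < lam) (hlam1 : lam ≤ 1) (hQ : 0 ≤ Q) (hN : 0 ≤ N) (h1 : lam⁻¹ ≤ lam ^ ρ * n)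
    (hη : √n ≤ 2 * c * ell) :
    Q / lam + N ≤ 4 * c ^ 2 * (Q + N) * lam ^ ρ * ell ^ 3 := by
  have hpow : 0 ≤ lam ^ ρ := by positivity
  have h2 : n ≤ 4 * c ^ 2 * ell ^ 2 := by
    have := pow_le_pow_left₀ (Real.sqrt_nonneg n) hη 2
    rw [Real.sq_sqrt hn] at this
    linarith
  have h3 : 1 ≤ lam⁻¹ := (one_le_inv₀ hlam).2 hlam1
  calc Q / lam + N ≤ (Q + N) * lam⁻¹ := by rw [div_eq_mul_inv]; nlinarith
    _ ≤ (Q + N) * (lam ^ ρ * (4 * c ^ 2 * ell ^ 2)) := by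
        refine mul_le_mul_of_nonneg_left (h1.trans ?_) (by positivity)
        gcongr
    _ = 4 * c ^ 2 * (Q + N) * lam ^ ρ * ell ^ 2 := by ring
    _ ≤ _ := by
        refine mul_le_mul_of_nonneg_left (pow_le_pow_right₀ hell (by norm_num)) (by positivity)

end Rate

end CovariateShift

/-! ### The learning rate -/

theorem corollary1
    -- a compact metric space, a Mercer kernel `K` on it and its reproducing kernel Hilbert space
    {X : Type*} [MetricSpace X] [CompactSpace X] [MeasurableSpace X] [BorelSpace X]
    {H : Type*} [NormedAddCommGroup H] [InnerProductSpace ℝ H] [CompleteSpace H] [RKHS ℝ H X ℝ]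
    (K : X → X → ℝ) (hK : CovariateShift.IsMercerKernel K)
    (hH : ∀ x y, RKHS.kernel H x y 1 = K x y)
    -- the interval `[0, U]` on which the filter is defined, with `U ≥ max {1, sup K(x, x)}`
    (U : ℝ) (hU : 1 ≤ U) (hKU : ∀ x, K x x ≤ U)
    -- the parameters
    (α C σ M R r b : ℝ) (γ : ℝ → ℝ) (νg : EReal)
    (hα : 0 < α) (hα1 : α ≤ 1) (hC : 0 < C) (hσ : 0 < σ)
    (hr : 1 / 2 ≤ r) (hrν : (r : EReal) ≤ νg) :
    ∃ C' : ℝ, 0 < C' ∧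
      -- conditional distribution and the training and test marginals
      ∀ (ρ : Kernel X ℝ) [IsMarkovKernel ρ]
        (ρtr ρte : Measure X) [IsProbabilityMeasure ρtr]
        [IsProbabilityMeasure ρte],
        ρte.AbsolutelyContinuous ρtr →
        (∀ᵐ z ∂(ρtr.compProd ρ), |z.2| ≤ M) →
        CovariateShift.WeightCondition ρtr ρte α C σ →
        CovariateShift.SourceCondition hK ρ ρte r R →
        ∀ g : ℝ → ℝ → ℝ, CovariateShift.IsFilterFunction U b γ νg g →
        ∀ n : ℕ, 1 ≤ n → ∀ δ : ℝ, 0 < δ → δ < 1 →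
          -- outside an event of probability at most `δ` the error bound holds
          Measure.pi (fun _ : Fin n => ρtr.compProd ρ)
            {z | ¬ eLpNorm
                (fun x => CovariateShift.normalizedEstimator H ρtr ρte
                    (g ((n : ℝ) ^ (-(1 / (min (2 * r) 3 + 1))))) z x
                  - CovariateShift.regressionFunction ρ x) 2 ρte
              ≤ ENNReal.ofReal (C' * (n : ℝ) ^ (-(min r (3 / 2) / (min (2 * r) 3 + 1)))
                  * Real.log (12 / δ) ^ 3)}
            ≤ ENNReal.ofReal δ := by
  -- the smoothness that counts, as saturated at `3 / 2`
  set q : ℝ := min r (3 / 2) with hq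
  set s : ℝ := q - 1 / 2 with hs
  have hq1 : 1 / 2 ≤ q := le_min hr (by norm_num)
  have hqr : q ≤ r := min_le_left _ _
  have hs0 : 0 ≤ s := by linarith
  have hs1 : s ≤ 1 := by have : q ≤ 3 / 2 := min_le_right _ _; linarith
  have hsq : s + 1 / 2 = q := by rw [hs]; ring
  have hmin : min (2 * r) 3 = 2 * q := by
    rw [hq, mul_min_of_nonneg _ _ two_pos.le]; norm_num
  have hU0 : 0 < U := by linarith
  set c : ℝ := CovariateShift.concentrationConst C σ with hc
  have hc0 : 0 < c := CovariateShift.concentrationConst_pos hC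
  set Rh : ℝ := U ^ (r - s - 1 / 2) * |R| with hRh
  set Rf : ℝ := U ^ s * U ^ (r - s - 1 / 2) * |R| with hRf
  set B : ℝ := (|M| + √U * Rf) * √U + 1 with hB
  have hRf0 : 0 ≤ Rf := by positivity
  have hB0 : 0 < B := by positivity
  -- `C₁` serves typical samples, `C₂` the others
  set C₁ : ℝ := (1 + 4 * U * c) * (4 * |b| * B * c
    + 2 ^ (s + 1 / 2) * (1 + |b| + |γ q|) * (4 * (1 + 4 * U * c) * Rh)) with hC₁
  set C₂ : ℝ := 4 * c ^ 2 * (√U * (|b| * (|M| * √U)) + √U * Rf) with hC₂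
  have hC₁0 : 0 ≤ C₁ := by positivity
  have hC₂0 : 0 ≤ C₂ := by positivity
  refine ⟨C₁ + C₂ + 1, by positivity, ?_⟩
  intro ρ _ ρtr ρte _ _ hac hM hw hsource g hg n hn δ hδ hδ1
  rw [hmin]
  set lam : ℝ := (n : ℝ) ^ (-(1 / (2 * q + 1))) with hlam
  obtain ⟨hlam0, hlam1, hlamn, hrate, hinv, hfin⟩ :=
    CovariateShift.regularization_facts hn hq1 hlam
  rw [← hfin]
  set ell : ℝ := Real.log (12 / δ) with hell
  have hell1 : 1 ≤ ell := CovariateShift.one_le_log_twelve_div hδ hδ1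
  have hn0 : (0 : ℝ) < n := by exact_mod_cast hn
  have hsn : 0 < √(n : ℝ) := Real.sqrt_pos.2 hn0
  have : Nonempty (Fin n) := Fin.pos_iff_nonempty.1 hn
  set η : ℝ := c * ell / √n with hη
  have hη0 : 0 ≤ η := by positivity
  -- the regression function as an element of the reproducing kernel Hilbert space
  obtain ⟨u, huR, hu⟩ := hsource
  obtain ⟨J, hJae, hJb⟩ := CovariateShift.exists_embedding hK hH hKU ρte
  obtain ⟨f, h, hJf, heig, hortho, hneg, hsum, hfn, hhn⟩ :=
    CovariateShift.exists_eigenvector_expansion J hU0.le hJb hs0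
      (show s + 1 / 2 ≤ r by rw [hsq]; exact hqr) u
  rw [CovariateShift.embedding_comp_adjoint hK hH hJae] at hJf
  have huR' : ‖u‖ ≤ |R| := huR.trans (le_abs_self R)
  have hfR : ‖f‖ ≤ Rf := hfn.trans (mul_le_mul_of_nonneg_left huR' (by positivity))
  have hhR : ∀ F : Finset ℝ, ‖∑ t ∈ F, h t‖ ≤ Rh := fun F => 
    (hhn F).trans (mul_le_mul_of_nonneg_left huR' (by positivity))
  have hreg : CovariateShift.regressionFunction ρ =ᵐ[ρte] f := by
    rw [← hJf] at hu
    exact hu.trans (hJae f)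
  -- the filter at the parameter `lam`
  have hb : |b| = b := abs_of_pos hg.b_pos
  have hqν : (q : EReal) ≤ νg := (EReal.coe_le_coe_iff.2 hqr).trans hrν
  have hγ : |γ q| = γ q := abs_of_pos (hg.γ_pos q (by linarith) hqν)
  have hlamU : lam ≤ U := hlam1.trans hU
  have hg1 : ∀ μ, 0 < μ → μ ≤ U → |g lam μ| ≤ |b| / lam := fun μ h0 h1 => by
    rw [hb]; exact hg.bound lam μ hlam0 hlamU h0 h1
  have hg2 : ∀ μ, 0 < μ → μ ≤ U → |g lam μ * μ| ≤ |b| := fun μ h0 h1 => by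
    rw [hb]; exact hg.bound_mul lam μ hlam0 hlamU h0 h1
  have hg3 : ∀ μ, 0 < μ → μ ≤ U →
      |1 - g lam μ * μ| * μ ^ (s + 1 / 2) ≤ |γ q| * lam ^ (s + 1 / 2) := fun μ h0 h1 => by
    rw [hγ, hsq]; exact hg.residual q (by linarith) hqν lam μ hlam0 hlamU h0 h1
  -- three concentration events and the almost sure bound on the outputs
  have hM' : ∀ᵐ z ∂(ρtr.compProd ρ), |z.2| ≤ |M| := hM.mono fun z hz => hz.trans (le_abs_self M)
  have hE1 := CovariateShift.measure_mean_weight_gt_le (ρ := ρ) hac hα hα1 hC hw hn hδ hδ1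
  have hE2 := CovariateShift.measure_empiricalOp_sub_gt_le (ρ := ρ) hK hH hU0 hKU hJae hac hα hα1
    hC hw hn hδ hδ1
  have hE3 := CovariateShift.measure_noise_gt_le hK hH hKU hac hα hα1 hC hw hM' hreg hB0
    (show (|M| + √U * ‖f‖) * √U ≤ B from by
      have : (|M| + √U * ‖f‖) * √U ≤ (|M| + √U * Rf) * √U := by gcongr
      linarith) hn hδ hδ1
  have hE4 : Measure.pi (fun _ : Fin n => ρtr.compProd ρ) {z | ¬ ∀ i, |(z i).2| ≤ |M|} = 0 := by
    refine ae_iff.1 (ae_all_iff.2 fun i => ?_)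
    exact (measurePreserving_eval (fun _ : Fin n => ρtr.compProd ρ) i).quasiMeasurePreserving.ae hM'
  rw [← hc, ← hell, ← hη] at hE1 hE2 hE3
  set E₁ := {z : Fin n → X × ℝ |
    η < |(n : ℝ)⁻¹ * ∑ i, CovariateShift.weight ρtr ρte (z i).1 - 1|} with hE₁
  set E₂ := {z : Fin n → X × ℝ | ¬ ∀ f : H, ‖(CovariateShift.empiricalOp H (fun i => (z i).1)
      (fun i => CovariateShift.weight ρtr ρte (z i).1)
        - ContinuousLinearMap.adjoint J ∘L J) f‖ ≤ U * η * ‖f‖} with hE₂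
  set E₃ := {z : Fin n → X × ℝ | B * η < ‖(n : ℝ)⁻¹ • ∑ i,
    (CovariateShift.weight ρtr ρte (z i).1 * ((z i).2 - f (z i).1)) •
      CovariateShift.kerSection H (z i).1‖} with hE₃
  set E₄ := {z : Fin n → X × ℝ | ¬ ∀ i, |(z i).2| ≤ |M|} with hE₄
  -- outside these four events the bound is deterministic
  refine (measure_mono (t := E₁ ∪ E₂ ∪ E₃ ∪ E₄) fun z hz => ?_).trans ?_
  · by_contra hgood
    simp only [Set.mem_union, not_or, hE₁, hE₂, hE₃, hE₄, Set.mem_ofPred_eq, not_not, not_lt]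
      at hgood
    obtain ⟨⟨⟨h1, h2⟩, h3⟩, h4⟩ := hgood
    refine hz ?_
    set F := CovariateShift.normalizedEstimator H ρtr ρte (g lam) z with hF
    have hnorm : eLpNorm (fun x => F x - CovariateShift.regressionFunction ρ x) 2 ρte
        = ENNReal.ofReal ‖J (F - f)‖ := by
      rw [ofReal_norm, Lp.enorm_def]
      refine eLpNorm_congr_ae ?_
      filter_upwards [hreg, hJae (F - f)] with x hx hx'
      rw [hx, hx', RKHS.coe_sub, Pi.sub_apply]
    rw [hnorm]
    apply ENNReal.ofReal_le_ofReal
    have hw0 : ∀ i, 0 ≤ CovariateShift.weight ρtr ρte (z i).1 := fun i =>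
      CovariateShift.weight_nonneg _
    have hsum3 : C₁ * lam ^ q * ell ^ 3 ≤ (C₁ + C₂ + 1) * lam ^ q * ell ^ 3 ∧
        C₂ * lam ^ q * ell ^ 3 ≤ (C₁ + C₂ + 1) * lam ^ q * ell ^ 3 := by
      constructor <;> (simp only [mul_assoc]; gcongr; linarith)
    rcases le_or_gt η (1 / 2) with hsmall | hlarge
    · refine le_trans ?_ hsum3.1
      have key := CovariateShift.norm_embedding_normalized_sub_le hH hU0.le hKU hJb
        (fun i => (z i).1) (y := fun i => (z i).2) hw0 hη0 hsmall h1 h2 hlam0 hs0 hs1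
        (abs_nonneg b) (abs_nonneg (γ q)) hg1 hg2 hg3 heig hortho hneg hsum hhR h3
      refine key.trans ?_
      have hrate' : (√lam * √n)⁻¹ = lam ^ (s + 1 / 2) := by rw [hrate, hsq]
      have := CovariateShift.typical_error_le (q := 2 ^ (s + 1 / 2)) hU0.le hc0.le (abs_nonneg b)
        hB0.le (show 0 ≤ Rh by positivity) (abs_nonneg (γ q)) (by positivity) hell1 hlam0
        hsn.le hlamn hrate'
      rw [← hη, ← hC₁] at this
      have e : lam ^ q = lam ^ (s + 1 / 2) := by rw [hsq]
      rw [e]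
      exact this
    · refine le_trans ?_ hsum3.2
      have key := CovariateShift.norm_embedding_estimator_sub_le hH hU0.le hKU hJb
        (fun i => (z i).1) (y := fun i => (z i).2) (CovariateShift.normalized_nonneg hw0)
        (CovariateShift.mean_normalized_le_one _) (abs_nonneg M) h4 (abs_nonneg b) hlam0 hg1 f
      refine key.trans ?_
      have hsn2 : √(n : ℝ) ≤ 2 * c * ell := by
        rw [hη, lt_div_iff₀ hsn] at hlarge
        linarith
      have := CovariateShift.untypical_error_le hn0.le hell1 hlam0 hlam1
        (Q := √U * (|b| * (|M| * √U))) (N := √U * Rf) (by positivity) (by positivity) hinv hsn2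
      refine le_trans ?_ this
      have e : √U * (|b| / lam * (|M| * √U) + ‖f‖)
          = √U * (|b| * (|M| * √U)) / lam + √U * ‖f‖ := by ring
      rw [e]
      gcongr
  · refine (measure_union_le _ _).trans ?_
    rw [hE4, add_zero]
    refine (measure_union_le _ _).trans ((add_le_add ((measure_union_le _ _).trans
      (add_le_add hE1 hE2)) hE3).trans (le_of_eq ?_))
    rw [← ENNReal.ofReal_add (by positivity) (by positivity),
      ← ENNReal.ofReal_add (by positivity) (by positivity)]
    congr 1; ring
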